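/- **Setting.** An autonomous polynomial differential equation of order $n$ is written $E(y_0,y_1,\dots,y_n)=0$ with $E\in\mathbb C[y_0,\dots,y_n]$ and $y_k=d^ky/dx^k$. For an integer $p\ge 1$ the *pole order* of a monomial $\prod_k y_k^{d_k}$ is $\sum_k (p+k)d_k$. The *reduced equation* $\hat E=0$ consists of the monomials of $E$ of highest pole order. A *branch* is a pair $(p,B)$ with $p\ge 1$ an integer and $B\ne 0$ such that $y=Bx^{-p}$ satisfies $\hat E=0$. Put $c_k=B(-p)(-p-1)\cdots(-p-k+1)$, the value of $(Bx^{-p})^{(k)}$ at $x=1$, and for a polynomial $F(y_0,y_1,\dots)$ let $$\Lambda_F(s)=\sum_k \frac{\partial F}{\partial y_k}(c)\,(s-p)(s-p-1)\cdots(s-p-k+1).$$ The *Fuchs indices* of the branch are the roots of $\Lambda_{\hat E}$. The equation $E=0$ has the *Painlevé property at the branch* $(p,B)$, in the sense of Painlevé analysis, if $\Lambda_{\hat E}$ has degree $n$, its $n$ roots are pairwise distinct integers, and the coefficients at the positive Fuchs indices are arbitrary: for every choice of numbers $a_j$ ($j$ ranging over the set $J_+$ of positive Fuchs indices) there is a formal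 Laurent solution $y=Bx^{-p}+\sum_{m\ge1}u_mx^{m-p}$ of $E=0$ with $u_j=a_j$ for all $j\in J_+$. The branch is *general* if every Fuchs index other than $-1$ is positive (so that the expansion contains $n-1$ arbitrary coefficients). A *polynomial first integral* of $\hat E=0$ is a $P\in\mathbb C[y_0,\dots,y_{n-1}]$ such that $$\Big(\frac{\partial \hat E}{\partial y_n}\Big)^{N}\sum_{k=0}^{n-1}y_{k+1}\frac{\partial P}{\partial y_k}=Q_0\,\hat E\qquad\text{for some } N\ge 0,\ Q_0\in\mathbb C[y_0,\dots,y_n].$$ **Theorem 2.1.** Let $(p,B)$ be a branch of $E=0$ at which $E=0$ has the Painlevé property. Then: 1. For every choice of $(a_j)_{j\in J_+}$ the reduced equation $\hat E=0$ has exactly one formal Laurent solution $y=Bx^{-p}+\sum_{m\ge1}u_mx^{m-p}$ with $u_j=a_j$ for all $j\in J_+$. Let $P$ be any polynomial first integral of $\hat E=0$. Then: 2. For each $M$ the sum of the members of $P$ of pole order $M$ is itself a first integral of $\hat E=0$. 3. The pole order of each monomial of $P$ is a combination $\sum_j k_j\,j$, with $k_j\in\{0,1,2,\dots\}$, of the Fuchs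 indices $j\neq -1$. 4. There is a polynomial $Q$ in the variables $a_j$, $j\in J_+$, such that $P$ takes the constant value $C=Q\big((a_j)_{j\in J_+}\big)$ on each Laurent solution $y$ of $\hat E=0$ as in 1. If the branch is general, then $Q$ is constant only if $P$ is constant: $Q=c\in\mathbb C$ implies $P=c$. 5. Suppose that all members of $P$ have the same pole order $M$. Then $Q$ is weighted homogeneous of weight $M$, where $a_j$ has weight $j$; in particular $C$ does not depend on the $a_j$ with $j>M$. If $M\in J_+$, then $$C=\Lambda_P(M)\,a_M+R\big((a_j)_{j\in J_+,\,j<M}\big)$$ with a polynomial $R$. If $\partial P/\partial y_k(c)\ne0$ for some $k$, then $M$ is itself a positive Fuchs index and $\Lambda_P(M)\neq0$; so $a_M$ is then the coefficient at the largest Fuchs index on which the constant $C$ depends, $C$ depends on it linearly, and the pole order of the members of $P$ equals that Fuchs index. -/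

import Mathlib

/-!
Autonomous polynomial differential equations `E(y, y', …, y⁽ⁿ⁾) = 0` are elements
`E` of `ℂ[y₀, …, yₙ]`, the variable `yₖ` standing for the `k`-th derivative of `y`.
-/

noncomputable section

namespace PainleveFirstIntegral

open MvPolynomial

/-- Substitution of a Laurent series `y(x)` into a differential polynomial `F(y₀, y₁, …)`:
`yₖ` is replaced by the `k`-th derivative of `y`. -/
def evalSeries {m : ℕ} (F : MvPolynomial (Fin m) ℂ) (y : LaurentSeries ℂ) : LaurentSeries ℂ :=
  aeval (fun k : Fin m => (LaurentSeries.derivative ℂ)^[(k : ℕ)] y) F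

/-- The pole order of `yₖ` when `y` has a pole of order `p`. The pole order of the member
`∏ yₖ ^ dₖ` of a differential polynomial is therefore `Finsupp.weight (poleWeight p) d`. -/
def poleWeight (p : ℕ) {m : ℕ} (k : Fin m) : ℕ := p + k

/-- The reduced equation (equation with leading members) for poles of order `p`: the members of
`E` of highest pole order. -/
def reducedEq {m : ℕ} (p : ℕ) (E : MvPolynomial (Fin m) ℂ) : MvPolynomial (Fin m) ℂ :=
  weightedHomogeneousComponent (poleWeight p) (weightedTotalDegree (poleWeight p) E) E

/-- `y = B / x ^ p` is a leading behaviour of `E = 0`: it is a nonzero solution, with a pole, of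
the reduced equation. -/
def IsPoleBranch {n : ℕ} (E : MvPolynomial (Fin (n + 1)) ℂ) (p : ℕ) (B : ℂ) : Prop :=
  1 ≤ p ∧ B ≠ 0 ∧ evalSeries (reducedEq p E) (HahnSeries.single (-(p : ℤ)) B) = 0

/-- The values at `x = 1` of `B / x ^ p` and of its derivatives: the `k`-th one is
`B * (-p) * (-p - 1) * ⋯ * (-p - k + 1)`. -/
def leadingJet {m : ℕ} (p : ℕ) (B : ℂ) (k : Fin m) : ℂ :=
  B * (descPochhammer ℂ (k : ℕ)).eval (-(p : ℂ))

/-- The polynomial in `s` that is the coefficient of `ε`, at `x = 1`, in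
`F[B x ^ (-p) + ε x ^ (s - p)]`, that is
`∑ₖ (∂F/∂yₖ)(leadingJet) * (s - p) * (s - p - 1) * ⋯ * (s - p - k + 1)`. -/
def linearization {m : ℕ} (F : MvPolynomial (Fin m) ℂ) (p : ℕ) (B : ℂ) : Polynomial ℂ :=
  ∑ k : Fin m, Polynomial.C (eval (leadingJet p B) (pderiv k F)) *
    (descPochhammer ℂ (k : ℕ)).comp (Polynomial.X - Polynomial.C (p : ℂ))

/-- The polynomial whose roots are the Fuchs indices of `E = 0` at the branch `B / x ^ p`. -/
def fuchsPoly {n : ℕ} (E : MvPolynomial (Fin (n + 1)) ℂ) (p : ℕ) (B : ℂ) : Polynomial ℂ :=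
  linearization (reducedEq p E) p B

/-- The integer Fuchs indices. -/
def fuchsIndices {n : ℕ} (E : MvPolynomial (Fin (n + 1)) ℂ) (p : ℕ) (B : ℂ) : Finset ℤ :=
  (fuchsPoly E p B).roots.toFinset.preimage (fun j : ℤ => (j : ℂ)) Int.cast_injective.injOn

/-- The positive Fuchs indices. -/
def posIndices {n : ℕ} (E : MvPolynomial (Fin (n + 1)) ℂ) (p : ℕ) (B : ℂ) : Finset ℕ :=
  ((fuchsIndices E p B).filter (fun j => 0 < j)).image Int.toNat

/-- `y = B x ^ (-p) + ∑_{m ≥ 1} aₘ x ^ (m - p)` is a formal Laurent solution of `E = 0`. -/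
def IsExpansion {n : ℕ} (E : MvPolynomial (Fin (n + 1)) ℂ) (p : ℕ) (B : ℂ)
    (y : LaurentSeries ℂ) : Prop :=
  evalSeries E y = 0 ∧ y.coeff (-(p : ℤ)) = B ∧ ∀ m : ℤ, m < -(p : ℤ) → y.coeff m = 0

/-- The Painlevé property at the branch `B / x ^ p`, in the sense of Painlevé analysis:
there are as many Fuchs indices as the order `n` of the equation, they are pairwise distinct
integers, and the coefficients at the positive Fuchs indices of the Laurent expansions of the
solutions are arbitrary. -/
def HasPainlevePropertyAt {n : ℕ} (E : MvPolynomial (Fin (n + 1)) ℂ) (p : ℕ) (B : ℂ) : Prop :=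
  (fuchsPoly E p B).degree = n ∧ (fuchsIndices E p B).card = n ∧
    ∀ a : posIndices E p B → ℂ, ∃ y : LaurentSeries ℂ, IsExpansion E p B y ∧
      ∀ j : posIndices E p B, y.coeff ((j : ℤ) - p) = a j

/-- The branch `B / x ^ p` represents the general solution: every Fuchs index other than `-1`
(which stands for the arbitrary position of the pole) is positive, so that with the position of
the pole the expansion contains `n` arbitrary constants. -/
def IsGeneralBranch {n : ℕ} (E : MvPolynomial (Fin (n + 1)) ℂ) (p : ℕ) (B : ℂ) : Prop :=
  ∀ j ∈ fuchsIndices E p B, j = -1 ∨ 0 < j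

/-- The total derivative `∑ₖ yₖ₊₁ ∂P/∂yₖ` of `P(y₀, …, yₙ₋₁)`. -/
def totalDeriv {n : ℕ} (P : MvPolynomial (Fin n) ℂ) : MvPolynomial (Fin (n + 1)) ℂ :=
  ∑ k : Fin n, X k.succ * rename Fin.castSucc (pderiv k P)

/-- `P(y₀, …, yₙ₋₁)` is a polynomial first integral of `E(y₀, …, yₙ) = 0`: its total derivative
is a multiple of `E`, with powers of `∂E/∂yₙ` allowed as denominators of the multiplier. For an
equation `yₙ = F(y₀, …, yₙ₋₁)`, where `E = yₙ - F` and `∂E/∂yₙ = 1`, this is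
`∑ₖ yₖ₊₁ ∂P/∂yₖ = Q * (yₙ - F)`. -/
def IsFirstIntegral {n : ℕ} (E : MvPolynomial (Fin (n + 1)) ℂ)
    (P : MvPolynomial (Fin n) ℂ) : Prop :=
  ∃ (N : ℕ) (Q : MvPolynomial (Fin (n + 1)) ℂ),
    (pderiv (Fin.last n) E) ^ N * totalDeriv P = Q * E

end PainleveFirstIntegral

end

noncomputable section

namespace PainleveFirstIntegral

open MvPolynomial

/-! Write `y = x^(-p) v` with a power series `v`. A differential polynomial `F` homogeneous of pole
order `M` then becomes `x^(-M)` times a power series `F[v]`. Its coefficient at `x^m`, `m ≥ 1`, is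
`Λ_F(m) v_m` plus terms in the earlier coefficients (`coeff_substSeries_sub`). So the reduced
equation is a triangular recursion, uniquely solvable except at the positive Fuchs indices, where
`Λ` vanishes and a compatibility condition remains.

These conditions are inherited from `E` by scaling. The substitution `x ↦ c x` turns solutions of `E
= 0` into solutions of an equation whose members of pole order `w` carry `c^(D-w)`. The conditions
are polynomial in `c` and hold for all `c ≠ 0`, hence also at `c = 0`, which is the reduced equation
(`HasPainlevePropertyAt.exists_solution`).

Running the recursion with variables `a_j` as free coefficients gives a series `V` whose coefficient
at `x^m` is weighted homogeneous of weight `m`. If `P` is a first integral of pole order `M`, then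
`x d/dx` multiplies `P[v]` by `M`, so `P[v]` is a single term `C x^M`. Thus `Q` is the coefficient
of `P[V]` at `x^M`, which gives its weight and, by the recursion formula, its dependence on `a_M`.

For the pole orders, expand `P` around the leading jet and let `f` be its lowest homogeneous part,
written in coordinates `t_i` along the jets of `x^(s_i-p)`, with `s_i` the Fuchs indices. These jets
annihilate the linear part of the reduced equation, so the lowest terms of the first integral
relation give `∑ s_i t_i ∂f/∂t_i = M f`, and `∂f/∂t_i = 0` for `s_i = -1`. Every monomial of `f`
therefore exhibits `M` as a combination of the other indices. If the gradient of `P` at the leading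
jet is nonzero, `f` is linear and `M` is itself an index.

At a general branch, suppose `P[V] = 0`. Differentiating in each `a_j` and in `x` gives linear
relations for the gradient of `P` along `V`; their lowest terms form an invertible Vandermonde-type
system. So the gradient vanishes on `V`, and induction on pole order gives `P = 0`. -/

/-! ### Falling factorials, Taylor's formula and the chain rule -/

/-- The falling factorial `(s - p) (s - p - 1) ⋯ (s - p - k + 1)`. -/
def fall (p k : ℕ) (s : ℂ) : ℂ := (descPochhammer ℂ k).eval (s - p)

lemma fall_succ (p k : ℕ) (s : ℂ) : fall p (k + 1) s = fall p k s * (s - (p + k)) := by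
  simp only [fall, descPochhammer_succ_right, Polynomial.eval_mul, Polynomial.eval_sub,
    Polynomial.eval_X, Polynomial.eval_natCast]
  ring

/-- Translating the pole perturbs `B x^(-p)` by its derivative `-p B x^(-1-p)`. Hence the shifted
leading jet points in the direction of the Fuchs index `-1`. -/
lemma fall_succ_zero (p k : ℕ) : fall p (k + 1) 0 = -p * fall p k (-1) := by
  simp only [fall, descPochhammer_succ_left, Polynomial.eval_mul, Polynomial.eval_comp,
    Polynomial.eval_sub, Polynomial.eval_X, Polynomial.eval_one]
  ring_nf

lemma leadingJet_eq {m : ℕ} (p : ℕ) (B : ℂ) (k : Fin m) : leadingJet p B k = B * fall p k 0 := by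
  simp [leadingJet, fall]

lemma leadingJet_succ {m : ℕ} (p : ℕ) (B : ℂ) (k : Fin m) :
    (leadingJet p B k.succ : ℂ) = -(p + k) * leadingJet p B k := by
  rw [leadingJet_eq, leadingJet_eq, Fin.val_succ, fall_succ]
  ring

lemma eval_linearization {m : ℕ} (F : MvPolynomial (Fin m) ℂ) (p : ℕ) (B s : ℂ) :
    (linearization F p B).eval s =
      ∑ k : Fin m, eval (leadingJet p B) (pderiv k F) * fall p k s := by
  simp [linearization, Polynomial.eval_finsetSum, fall]

/-- Taylor's formula to first order for the substitution of ring elements into a polynomial. -/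
lemma aeval_sub_aeval_sub_mem {σ R A : Type*} [Fintype σ] [CommRing R] [CommRing A] [Algebra R A]
    (I : Ideal A) (u u' : σ → A) (h : ∀ k, u k - u' k ∈ I) (F : MvPolynomial σ R) :
    aeval u F - aeval u' F - ∑ k, aeval u' (pderiv k F) * (u k - u' k) ∈ I ^ 2 := by
  classical
  induction F using MvPolynomial.induction_on with
  | C a => simp
  | add f g hf hg =>
    convert Ideal.add_mem _ hf hg using 1
    simp only [map_add, add_mul, Finset.sum_add_distrib]
    ring
  | mul_X f i hf =>
    have hd : aeval u f - aeval u' f ∈ I := by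
      have h1 := Ideal.pow_le_self two_ne_zero hf
      have h2 : ∑ k, aeval u' (pderiv k f) * (u k - u' k) ∈ I :=
        Ideal.sum_mem _ fun k _ => Ideal.mul_mem_left _ _ (h k)
      simpa using Ideal.add_mem _ h1 h2
    have h3 : (aeval u f - aeval u' f) * (u i - u' i) ∈ I ^ 2 := by
      rw [pow_two]; exact Ideal.mul_mem_mul hd (h i)
    convert Ideal.add_mem _ (Ideal.mul_mem_left _ (u' i) hf) h3 using 1
    simp only [map_mul, aeval_X, pderiv_mul, map_add, add_mul, Finset.sum_add_distrib, pderiv_X,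
      Pi.single_apply]
    have : ∑ x, aeval u' f * aeval u' (if i = x then (1 : MvPolynomial σ R) else 0) *
        (u x - u' x) = aeval u' f * (u i - u' i) := by
      rw [Finset.sum_eq_single i] <;> simp +contextual [eq_comm]
    have h4 : ∑ x, aeval u' (pderiv x f) * u' i * (u x - u' x) =
        u' i * ∑ k, aeval u' (pderiv k f) * (u k - u' k) := by
      rw [Finset.mul_sum]
      exact Finset.sum_congr rfl fun _ _ => by ring
    rw [this, h4]
    ring

/-- The chain rule for a derivation and a substitution into a polynomial. -/
lemma derivation_aeval {σ R A : Type*} [Fintype σ] [CommRing R] [CommRing A] [Algebra R A]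
    (D : Derivation R A A) (u : σ → A) (F : MvPolynomial σ R) :
    D (aeval u F) = ∑ k, aeval u (pderiv k F) * D (u k) := by
  classical
  induction F using MvPolynomial.induction_on with
  | C a => simp
  | add f g hf hg => simp [hf, hg, add_mul, Finset.sum_add_distrib]
  | mul_X f i hf =>
    have h : ∀ x, aeval u (pderiv x (f * X i)) * D (u x) =
        u i * (aeval u (pderiv x f) * D (u x)) + if i = x then aeval u f * D (u x) else 0 := by
      intro x
      rw [pderiv_mul, pderiv_X, Pi.single_apply]
      split_ifs <;> simp
      all_goals ring
    simp_rw [h, Finset.sum_add_distrib, ← Finset.mul_sum, ← hf]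
    simp [Derivation.leibniz, add_comm]

/-! ### Substitution of a series with a pole of order `p` -/

section Series

variable {A : Type*} [CommRing A] [Algebra ℂ A]

/-- If `y = x ^ (-p) v`, then the `k`-th derivative of `y` is `x ^ (-p - k) (jetSeries p k v)`. -/
def jetSeries (p k : ℕ) (v : PowerSeries A) : PowerSeries A :=
  PowerSeries.mk fun m => fall p k m • PowerSeries.coeff m v

@[simp] lemma coeff_jetSeries (p k m : ℕ) (v : PowerSeries A) :
    PowerSeries.coeff m (jetSeries p k v) = fall p k m • PowerSeries.coeff m v := by
  simp [jetSeries]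

/-- Substitution of `y = x ^ (-p) v` into a differential polynomial, without the powers of `x`:
on weighted homogeneous polynomials it differs from `evalSeries` by a power of `x`. -/
def substSeries (p : ℕ) {m : ℕ} (F : MvPolynomial (Fin m) ℂ) (v : PowerSeries A) :
    PowerSeries A :=
  aeval (fun k : Fin m => jetSeries p k v) F

lemma map_jetSeries {A' : Type*} [CommRing A'] [Algebra ℂ A'] (φ : A →ₐ[ℂ] A') (p k : ℕ)
    (v : PowerSeries A) :
    PowerSeries.map (φ : A →+* A') (jetSeries p k v) =
      jetSeries p k (PowerSeries.map (φ : A →+* A') v) := by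
  ext m
  simp

lemma map_substSeries {A' : Type*} [CommRing A'] [Algebra ℂ A'] (φ : A →ₐ[ℂ] A') (p : ℕ) {m : ℕ}
    (F : MvPolynomial (Fin m) ℂ) (v : PowerSeries A) :
    PowerSeries.map (φ : A →+* A') (substSeries p F v) =
      substSeries p F (PowerSeries.map (φ : A →+* A') v) := by
  have h : PowerSeries.map (φ : A →+* A') (substSeries p F v) =
      PowerSeries.mapAlgHom φ (substSeries p F v) := rfl
  rw [h, substSeries, ← AlgHom.comp_apply, comp_aeval]
  simp only [substSeries]
  congr 2
  ext1 k
  exact map_jetSeries φ p k v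

lemma rescale_substSeries (a : ℂ) (p : ℕ) {m : ℕ}
    (F : MvPolynomial (Fin m) ℂ) (v : PowerSeries ℂ) :
    PowerSeries.rescale a (substSeries p F v) = substSeries p F (PowerSeries.rescale a v) := by
  have h : PowerSeries.rescale a (substSeries p F v) =
      PowerSeries.rescaleAlgHom a (substSeries p F v) := by
    rw [← PowerSeries.coe_rescaleAlgHom]; rfl
  rw [h, substSeries, ← AlgHom.comp_apply, comp_aeval]
  simp only [substSeries]
  congr 2
  ext1 k
  rw [← AlgHom.coe_toRingHom, PowerSeries.coe_rescaleAlgHom]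
  ext i
  simp [PowerSeries.coeff_rescale]
  ring

lemma constantCoeff_substSeries (p : ℕ) (B : ℂ) {m : ℕ} (F : MvPolynomial (Fin m) ℂ)
    (v : PowerSeries A) (hv : PowerSeries.coeff 0 v = algebraMap ℂ A B) :
    PowerSeries.coeff 0 (substSeries p F v) =
      algebraMap ℂ A (eval (leadingJet p B) F) := by
  have h : ∀ f : PowerSeries A, PowerSeries.coeff 0 f = PowerSeries.constantCoeff f := by simp
  induction F using MvPolynomial.induction_on with
  | C a => simp [substSeries, PowerSeries.algebraMap_apply]
  | add f g hf hg => simp only [substSeries, map_add] at hf hg ⊢; rw [hf, hg]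
  | mul_X f i hf =>
    have : PowerSeries.coeff 0 (jetSeries p i v) = algebraMap ℂ A (leadingJet p B i) := by
      rw [coeff_jetSeries, hv, leadingJet_eq, Algebra.smul_def, ← map_mul]
      simp [mul_comm]
    simp only [h] at hf this ⊢
    simp only [substSeries, map_mul, aeval_X, eval_X] at hf ⊢
    rw [hf, this]

/-- The coefficient at `x ^ m` of a substitution depends on the coefficient of `v` at `x ^ m`
through the linearization. -/
lemma coeff_substSeries_sub (p : ℕ) (B : ℂ) {m : ℕ} (hm : 1 ≤ m) {l : ℕ}
    (F : MvPolynomial (Fin l) ℂ) (v v' : PowerSeries A)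
    (hv : PowerSeries.coeff 0 v = algebraMap ℂ A B)
    (h : ∀ i < m, PowerSeries.coeff i v = PowerSeries.coeff i v') :
    PowerSeries.coeff m (substSeries p F v) - PowerSeries.coeff m (substSeries p F v') =
      (linearization F p B).eval (m : ℂ) • (PowerSeries.coeff m v - PowerSeries.coeff m v') := by
  have hd : ∀ k : Fin l, (PowerSeries.X : PowerSeries A) ^ m ∣
      jetSeries p k v - jetSeries p k v' := fun k => by
    rw [PowerSeries.X_pow_dvd_iff]
    intro i hi
    simp [h i hi]
  have ht := aeval_sub_aeval_sub_mem (Ideal.span {(PowerSeries.X : PowerSeries A) ^ m})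
    (fun k : Fin l => jetSeries p k v) (fun k : Fin l => jetSeries p k v')
    (fun k => Ideal.mem_span_singleton.2 (hd k)) F
  rw [Ideal.span_singleton_pow, Ideal.mem_span_singleton, ← pow_mul,
    PowerSeries.X_pow_dvd_iff] at ht
  -- The quadratic remainder is divisible by `X^(2m)`, and `m < 2m` because `m ≥ 1`; only the linear
  -- term reaches `X^m`.
  have ht := ht m (by omega)
  rw [map_sub, map_sub, sub_eq_zero] at ht
  simp only [substSeries]
  rw [ht, map_sum, eval_linearization, Finset.sum_smul]
  refine Finset.sum_congr rfl fun k _ => ?_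
  obtain ⟨g, hg⟩ := hd k
  have h0 : PowerSeries.coeff 0 (aeval (fun k : Fin l => jetSeries p k v') (pderiv k F)) =
      algebraMap ℂ A (eval (leadingJet p B) (pderiv k F)) :=
    constantCoeff_substSeries p B (pderiv k F) v' (by rw [← h 0 (by omega), hv])
  have h1 := congrArg (PowerSeries.coeff m) hg
  rw [hg, mul_left_comm, PowerSeries.coeff_X_pow_mul', if_pos le_rfl, Nat.sub_self,
    PowerSeries.coeff_zero_eq_constantCoeff_apply, map_mul,
    ← PowerSeries.coeff_zero_eq_constantCoeff_apply,
    ← PowerSeries.coeff_zero_eq_constantCoeff_apply, h0]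
  rw [PowerSeries.coeff_X_pow_mul', if_pos le_rfl, Nat.sub_self, map_sub, coeff_jetSeries,
    coeff_jetSeries, ← smul_sub] at h1
  rw [← h1, mul_smul, ← Algebra.smul_def]

lemma X_pow_dvd_substSeries_sub (p : ℕ) {m : ℕ} {l : ℕ}
    (F : MvPolynomial (Fin l) ℂ) (v v' : PowerSeries A)
    (h : ∀ i < m, PowerSeries.coeff i v = PowerSeries.coeff i v') :
    (PowerSeries.X : PowerSeries A) ^ m ∣ substSeries p F v - substSeries p F v' := by
  have hd : ∀ k : Fin l, jetSeries p k v - jetSeries p k v' ∈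
      Ideal.span {(PowerSeries.X : PowerSeries A) ^ m} := fun k => by
    rw [Ideal.mem_span_singleton, PowerSeries.X_pow_dvd_iff]
    intro i hi
    simp [h i hi]
  have ht := aeval_sub_aeval_sub_mem (Ideal.span {(PowerSeries.X : PowerSeries A) ^ m})
    (fun k : Fin l => jetSeries p k v) (fun k : Fin l => jetSeries p k v') hd F
  rw [← Ideal.mem_span_singleton]
  simpa [substSeries] using Ideal.add_mem _ (Ideal.pow_le_self two_ne_zero ht)
    (Ideal.sum_mem _ fun k _ => Ideal.mul_mem_left _ (aeval (fun k : Fin l => jetSeries p k v')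
      (pderiv k F)) (hd k) : (∑ k, _) ∈ _)

end Series

/-! ### Triangular recursions and the scaling deformation -/

section Recursion

variable {A : Type*} [CommRing A] [Algebra ℂ A]

/-- The coefficient of `G v` at `x ^ m` depends only on the coefficients of `v` up to `x ^ m`, and
on the last one through multiplication by `Λ m`. -/
def IsRecursive (B : ℂ) (Λ : Polynomial ℂ) (G : PowerSeries A → PowerSeries A) : Prop :=
  ∀ m : ℕ, 1 ≤ m → ∀ v v' : PowerSeries A, PowerSeries.coeff 0 v = algebraMap ℂ A B →
    (∀ i < m, PowerSeries.coeff i v = PowerSeries.coeff i v') →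
    PowerSeries.coeff m (G v) - PowerSeries.coeff m (G v') =
      Λ.eval (m : ℂ) • (PowerSeries.coeff m v - PowerSeries.coeff m v')

/-- `v` has leading coefficient `B` and solves `G v = 0` except perhaps at the positions in `J`. -/
def IsPartialSolution (B : ℂ) (J : Finset ℕ) (G : PowerSeries A → PowerSeries A)
    (v : PowerSeries A) : Prop :=
  PowerSeries.coeff 0 v = algebraMap ℂ A B ∧
    ∀ m : ℕ, 1 ≤ m → m ∉ J → PowerSeries.coeff m (G v) = 0

/-- Induction on the position: off `J` the factor `Λ m` is invertible and determines the
coefficient; on `J` the coefficients agree by assumption. -/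
lemma IsPartialSolution.unique {B : ℂ} {Λ : Polynomial ℂ} {J : Finset ℕ}
    {G : PowerSeries A → PowerSeries A} (hG : IsRecursive B Λ G)
    (hΛ : ∀ m : ℕ, 1 ≤ m → m ∉ J → Λ.eval (m : ℂ) ≠ 0) {v v' : PowerSeries A}
    (hv : IsPartialSolution B J G v) (hv' : IsPartialSolution B J G v')
    (h : ∀ j ∈ J, PowerSeries.coeff j v = PowerSeries.coeff j v') : v = v' := by
  ext m
  induction m using Nat.strong_induction_on with
  | _ m ih =>
    rcases Nat.eq_zero_or_pos m with rfl | hm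
    · rw [hv.1, hv'.1]
    by_cases hJ : m ∈ J
    · exact h m hJ
    have h1 := hG m hm v v' hv.1 ih
    rw [hv.2 m hm hJ, hv'.2 m hm hJ, sub_self] at h1
    have h2 := congrArg (fun a => (Λ.eval (m : ℂ))⁻¹ • a) h1.symm
    simp only [smul_smul, inv_mul_cancel₀ (hΛ m hm hJ), one_smul, smul_zero] at h2
    exact sub_eq_zero.1 h2

/-- The coefficients of the solution of a recursive equation, with given coefficients at the
positions in `J`. -/
def solutionCoeff (B : ℂ) (Λ : Polynomial ℂ) (J : Finset ℕ)
    (G : PowerSeries A → PowerSeries A) (b : ℕ → A) (m : ℕ) : A :=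
  if m = 0 then algebraMap ℂ A B else if m ∈ J then b m else
    -- With the provisional value 0 at position `m`, the coefficient of `G` collects exactly the
    -- contribution of the earlier coefficients, which the true value must cancel.
    -((Λ.eval (m : ℂ))⁻¹ • PowerSeries.coeff m (G (PowerSeries.mk fun i =>
      if _h : i < m then solutionCoeff B Λ J G b i else 0)))
termination_by m

/-- Nothing is claimed about the equations at positions in `J`: these are the compatibility
conditions at the resonances. -/
lemma exists_isPartialSolution {B : ℂ} {Λ : Polynomial ℂ} {J : Finset ℕ} (h0 : 0 ∉ J)
    {G : PowerSeries A → PowerSeries A} (hG : IsRecursive B Λ G)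
    (hΛ : ∀ m : ℕ, 1 ≤ m → m ∉ J → Λ.eval (m : ℂ) ≠ 0) (b : ℕ → A) :
    ∃ v, IsPartialSolution B J G v ∧ ∀ j ∈ J, PowerSeries.coeff j v = b j := by
  have hB : solutionCoeff B Λ J G b 0 = algebraMap ℂ A B := by
    rw [solutionCoeff, if_pos rfl]
  refine ⟨PowerSeries.mk (solutionCoeff B Λ J G b), ⟨by simp [hB], fun m hm hJ => ?_⟩, ?_⟩
  · have h1 := hG m hm (PowerSeries.mk (solutionCoeff B Λ J G b))
      (PowerSeries.mk fun i => if _h : i < m then solutionCoeff B Λ J G b i else 0)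
      (by simp [hB]) (fun i hi => by simp [hi])
    rw [PowerSeries.coeff_mk, PowerSeries.coeff_mk, dif_neg (lt_irrefl m), sub_zero] at h1
    have h2 : solutionCoeff B Λ J G b m = -((Λ.eval (m : ℂ))⁻¹ • PowerSeries.coeff m
        (G (PowerSeries.mk fun i => if _h : i < m then solutionCoeff B Λ J G b i else 0))) := by
      rw [solutionCoeff, if_neg (by omega), if_neg hJ]
    rw [h2, smul_neg, smul_smul, mul_inv_cancel₀ (hΛ m hm hJ),
      one_smul, sub_eq_iff_eq_add, neg_add_cancel] at h1
    exact h1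
  · intro j hj
    rw [PowerSeries.coeff_mk, solutionCoeff, if_neg (by rintro rfl; exact h0 hj), if_pos hj]

lemma isRecursive_substSeries (p : ℕ) (B : ℂ) {l : ℕ} (F : MvPolynomial (Fin l) ℂ) :
    IsRecursive (A := A) B (linearization F p B) (substSeries p F) :=
  fun _ hm v v' hv h => coeff_substSeries_sub p B hm F v v' hv h

/-- Substitution of `x ^ (-p) v` into the differential polynomial `E`, the members of pole order
`w` being multiplied by the power `D - w` of the parameter `c`; the factor `x ^ (-D)` is omitted. -/
def deformedSubst (p : ℕ) {l : ℕ} (E : MvPolynomial (Fin l) ℂ) (D : ℕ) (c : A)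
    (v : PowerSeries A) : PowerSeries A :=
  ∑ w ∈ Finset.range (D + 1), (PowerSeries.C c * PowerSeries.X) ^ (D - w) *
    substSeries p (weightedHomogeneousComponent (poleWeight p) w E) v

lemma deformedSubst_eq (p : ℕ) {l : ℕ} (E : MvPolynomial (Fin l) ℂ) (D : ℕ) (c : A)
    (v : PowerSeries A) :
    deformedSubst p E D c v = (∑ w ∈ Finset.range D, (PowerSeries.C c * PowerSeries.X) ^ (D - w) *
      substSeries p (weightedHomogeneousComponent (poleWeight p) w E) v) +
      substSeries p (weightedHomogeneousComponent (poleWeight p) D E) v := by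
  rw [deformedSubst, Finset.sum_range_succ, Nat.sub_self, pow_zero, one_mul]

lemma deformedSubst_zero (p : ℕ) {l : ℕ} (E : MvPolynomial (Fin l) ℂ) (D : ℕ)
    (v : PowerSeries A) :
    deformedSubst p E D 0 v = substSeries p (weightedHomogeneousComponent (poleWeight p) D E) v := by
  rw [deformedSubst_eq, Finset.sum_eq_zero, zero_add]
  intro w hw
  rw [map_zero, zero_mul, zero_pow, zero_mul]
  have := Finset.mem_range.1 hw
  omega

lemma map_deformedSubst {A' : Type*} [CommRing A'] [Algebra ℂ A'] (φ : A →ₐ[ℂ] A') (p : ℕ)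
    {l : ℕ} (E : MvPolynomial (Fin l) ℂ) (D : ℕ) (c : A) (v : PowerSeries A) :
    PowerSeries.map (φ : A →+* A') (deformedSubst p E D c v) =
      deformedSubst p E D (φ c) (PowerSeries.map (φ : A →+* A') v) := by
  simp [deformedSubst, map_substSeries]

/-- The scaling `x ↦ a x` only multiplies the deformation parameter. It carries solutions of `E = 0`
(parameter 1) to solutions of every member of the family with nonzero parameter. -/
lemma rescale_deformedSubst (a c : ℂ) (p : ℕ) {l : ℕ} (E : MvPolynomial (Fin l) ℂ) (D : ℕ)
    (v : PowerSeries ℂ) :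
    PowerSeries.rescale a (deformedSubst p E D c v) =
      deformedSubst p E D (a * c) (PowerSeries.rescale a v) := by
  simp only [deformedSubst, map_sum, map_mul, map_pow, rescale_substSeries, PowerSeries.rescale_X]
  refine Finset.sum_congr rfl fun w _ => ?_
  congr 2
  have h : PowerSeries.rescale a (PowerSeries.C c) = PowerSeries.C c := by
    ext i
    rw [PowerSeries.coeff_rescale, PowerSeries.coeff_C]
    split_ifs with hi <;> simp [hi]
  rw [h]
  ring

/-- Members of pole order below `D` carry a positive power of `X`, so at position `m` they see only
coefficients of `v` before `m`. The linearization thus comes from the top members alone, whatever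
`c` is. -/
lemma isRecursive_deformedSubst (p : ℕ) (B : ℂ) {l : ℕ} (E : MvPolynomial (Fin l) ℂ) (D : ℕ)
    (c : A) :
    IsRecursive B (linearization (weightedHomogeneousComponent (poleWeight p) D E) p B)
      (deformedSubst p E D c) := by
  intro m hm v v' hv h
  rw [deformedSubst_eq, deformedSubst_eq, map_add, map_add,
    ← coeff_substSeries_sub p B hm _ v v' hv h, map_sum, map_sum, add_sub_add_comm,
    ← Finset.sum_sub_distrib, Finset.sum_eq_zero, zero_add]
  intro w hw
  have hw := Finset.mem_range.1 hw
  obtain ⟨g, hg⟩ := X_pow_dvd_substSeries_sub p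
    (weightedHomogeneousComponent (poleWeight p) w E) v v' h
  rw [← map_sub, ← mul_sub, hg, mul_pow, ← map_pow, mul_assoc, PowerSeries.coeff_C_mul,
    ← mul_assoc, ← pow_add, PowerSeries.coeff_X_pow_mul', if_neg (by omega), mul_zero]

end Recursion

/-! ### From power series to Laurent series -/

/-- The Laurent series `x ^ (-p) v`. -/
def laurentOf (p : ℕ) (v : PowerSeries ℂ) : LaurentSeries ℂ :=
  HahnSeries.single (-(p : ℤ)) 1 * HahnSeries.ofPowerSeries ℤ ℂ v

lemma coeff_laurentOf_add (p : ℕ) (v : PowerSeries ℂ) (m : ℤ) :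
    (laurentOf p v).coeff m = (HahnSeries.ofPowerSeries ℤ ℂ v).coeff (m + p) := by
  have := HahnSeries.coeff_single_mul_add (x := HahnSeries.ofPowerSeries ℤ ℂ v) (r := (1 : ℂ))
    (a := m + p) (b := -(p : ℤ))
  rw [one_mul, add_neg_cancel_right] at this
  exact this

lemma coeff_laurentOf (p : ℕ) (v : PowerSeries ℂ) (m : ℕ) :
    (laurentOf p v).coeff ((m : ℤ) - p) = PowerSeries.coeff m v := by
  rw [coeff_laurentOf_add, sub_add_cancel, HahnSeries.ofPowerSeries_apply_coeff]

lemma coeff_laurentOf_of_lt (p : ℕ) (v : PowerSeries ℂ) (m : ℤ) (hm : m < -(p : ℤ)) :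
    (laurentOf p v).coeff m = 0 := by
  rw [coeff_laurentOf_add, HahnSeries.ofPowerSeries_apply, HahnSeries.embDomain_of_notMem_range]
  rintro ⟨i, hi⟩
  simp at hi
  omega

lemma exists_laurentOf_eq (p : ℕ) (y : LaurentSeries ℂ) (hy : ∀ m < -(p : ℤ), y.coeff m = 0) :
    ∃ v, laurentOf p v = y := by
  refine ⟨PowerSeries.mk fun m => y.coeff ((m : ℤ) - p), ?_⟩
  ext m
  rcases lt_or_ge m (-(p : ℤ)) with h | h
  · rw [coeff_laurentOf_of_lt p _ m h, hy m h]
  · obtain ⟨i, hi⟩ := Int.eq_ofNat_of_zero_le (show 0 ≤ m + p by omega)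
    obtain rfl : m = (i : ℤ) - p := by omega
    rw [coeff_laurentOf, PowerSeries.coeff_mk]

lemma laurentOf_injective (p : ℕ) : Function.Injective (laurentOf p) := by
  intro v v' h
  ext m
  rw [← coeff_laurentOf p, ← coeff_laurentOf p, h]

lemma derivative_iterate_laurentOf (p k : ℕ) (v : PowerSeries ℂ) :
    (LaurentSeries.derivative ℂ)^[k] (laurentOf p v) = laurentOf (p + k) (jetSeries p k v) := by
  ext m
  rw [LaurentSeries.derivative_iterate_coeff]
  rcases lt_or_ge m (-((p + k : ℕ) : ℤ)) with h | h
  · rw [coeff_laurentOf_of_lt _ _ m h, coeff_laurentOf_of_lt _ _ _ (by push_cast at h; omega),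
      smul_zero]
  · obtain ⟨i, hi⟩ := Int.eq_ofNat_of_zero_le (show 0 ≤ m + (p + k : ℕ) by omega)
    obtain rfl : m = (i : ℤ) - (p + k : ℕ) := by omega
    rw [coeff_laurentOf, coeff_jetSeries]
    have : ((i : ℤ) - (p + k : ℕ) + k) = (i : ℤ) - p := by push_cast; ring
    rw [this, coeff_laurentOf, ← Polynomial.eval_eq_smeval, ← Int.cast_smul_eq_zsmul ℂ]
    congr 1
    rw [fall, ← descPochhammer_map (Int.castRingHom ℂ)]
    have h2 : ((i : ℂ) - p) = Int.castRingHom ℂ ((i : ℤ) - p) := by simp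
    rw [h2, Polynomial.eval_map_apply]
    rfl

lemma laurentOf_eq_pow_mul (p : ℕ) (v : PowerSeries ℂ) :
    laurentOf p v = (HahnSeries.single (-1 : ℤ) (1 : ℂ)) ^ p * HahnSeries.ofPowerSeries ℤ ℂ v := by
  rw [laurentOf, HahnSeries.single_pow]
  simp

/-- Multiplication of the variables by powers of a ring element, in a weighted homogeneous
polynomial. -/
lemma eval₂_pow_mul {σ R A : Type*} [CommRing R] [CommRing A] (f : R →+* A)
    (w : σ → ℕ) (t : A) (u : σ → A) {F : MvPolynomial σ R} {M : ℕ}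
    (hF : IsWeightedHomogeneous w F M) :
    eval₂ f (fun k => t ^ w k * u k) F = t ^ M * eval₂ f u F := by
  rw [eval₂_eq, eval₂_eq, Finset.mul_sum]
  refine Finset.sum_congr rfl fun d hd => ?_
  rw [← hF (mem_support_iff.1 hd), Finsupp.weight_apply, Finsupp.sum]
  simp_rw [mul_pow, Finset.prod_mul_distrib, ← pow_mul]
  rw [Finset.prod_pow_eq_pow_sum]
  simp_rw [smul_eq_mul, mul_comm (w _)]
  ring

lemma evalSeries_eq_eval₂ {l : ℕ} (F : MvPolynomial (Fin l) ℂ) (y : LaurentSeries ℂ) :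
    evalSeries F y =
      eval₂ HahnSeries.C (fun k : Fin l => (LaurentSeries.derivative ℂ)^[(k : ℕ)] y) F := by
  rw [evalSeries, aeval_def]
  congr 1
  ext1 c
  rw [HahnSeries.algebraMap_apply', ← HahnSeries.ofPowerSeries_C]
  rfl

lemma ofPowerSeries_substSeries (p : ℕ) {l : ℕ} (F : MvPolynomial (Fin l) ℂ) (v : PowerSeries ℂ) :
    HahnSeries.ofPowerSeries ℤ ℂ (substSeries p F v) =
      eval₂ HahnSeries.C (fun k : Fin l => HahnSeries.ofPowerSeries ℤ ℂ (jetSeries p k v)) F := by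
  rw [substSeries, map_aeval, coe_eval₂Hom]
  congr 1
  ext1 c
  exact HahnSeries.ofPowerSeries_C c

lemma evalSeries_laurentOf (p : ℕ) {l : ℕ} {F : MvPolynomial (Fin l) ℂ} {M : ℕ}
    (hF : IsWeightedHomogeneous (poleWeight p) F M) (v : PowerSeries ℂ) :
    evalSeries F (laurentOf p v) = laurentOf M (substSeries p F v) := by
  rw [evalSeries_eq_eval₂, laurentOf_eq_pow_mul M, ofPowerSeries_substSeries,
    ← eval₂_pow_mul _ (poleWeight p) _ _ hF]
  congr 1
  ext1 k
  rw [derivative_iterate_laurentOf, laurentOf_eq_pow_mul]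
  rfl

lemma sum_range_component {σ R : Type*} [CommRing R] {w : σ → ℕ}
    (f : MvPolynomial σ R) {D : ℕ}
    (hD : weightedTotalDegree w f ≤ D) :
    ∑ i ∈ Finset.range (D + 1), weightedHomogeneousComponent w i f = f := by
  conv_rhs => rw [← finsum_weightedHomogeneousComponent w f]
  refine (finsum_eq_sum_of_support_subset _ fun i hi => ?_).symm
  by_contra h
  apply hi
  refine weightedHomogeneousComponent_eq_zero _ _ (lt_of_le_of_lt hD ?_)
  simpa [Nat.lt_succ_iff] using h

lemma evalSeries_laurentOf_eq_deformedSubst (p : ℕ) {l : ℕ} (E : MvPolynomial (Fin l) ℂ)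
    (v : PowerSeries ℂ) :
    evalSeries E (laurentOf p v) = laurentOf (weightedTotalDegree (poleWeight p) E)
      (deformedSubst p E (weightedTotalDegree (poleWeight p) E) 1 v) := by
  set D := weightedTotalDegree (poleWeight p) E with hD
  conv_lhs => rw [← sum_range_component E hD.ge]
  have h1 : evalSeries (∑ w ∈ Finset.range (D + 1),
      weightedHomogeneousComponent (poleWeight p) w E) (laurentOf p v) =
      ∑ w ∈ Finset.range (D + 1), evalSeries (weightedHomogeneousComponent (poleWeight p) w E)
        (laurentOf p v) := map_sum _ _ _
  rw [h1, laurentOf_eq_pow_mul D, deformedSubst, map_sum, Finset.mul_sum]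
  refine Finset.sum_congr rfl fun w hw => ?_
  have hw : w ≤ D := Nat.lt_succ_iff.1 (Finset.mem_range.1 hw)
  rw [evalSeries_laurentOf p (weightedHomogeneousComponent_isWeightedHomogeneous w E),
    laurentOf_eq_pow_mul, map_one PowerSeries.C, one_mul, map_mul, map_pow, HahnSeries.ofPowerSeries_X,
    ← mul_assoc]
  congr 1
  have h3 : (HahnSeries.single (-1 : ℤ) (1 : ℂ)) ^ D = HahnSeries.single (-1 : ℤ) (1 : ℂ) ^ w *
      HahnSeries.single (-1 : ℤ) (1 : ℂ) ^ (D - w) := by rw [← pow_add, Nat.add_sub_cancel' hw]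
  have h4 : (HahnSeries.single (-1 : ℤ) (1 : ℂ)) ^ (D - w) *
      HahnSeries.single (1 : ℤ) (1 : ℂ) ^ (D - w) = 1 := by rw [← mul_pow]; simp
  rw [h3, mul_assoc, h4, mul_one]

/-! ### Laurent solutions of the reduced equation -/

variable {n : ℕ} {E : MvPolynomial (Fin (n + 1)) ℂ} {p : ℕ} {B : ℂ}

lemma mem_fuchsIndices (h : fuchsPoly E p B ≠ 0) (j : ℤ) :
    j ∈ fuchsIndices E p B ↔ (fuchsPoly E p B).eval (j : ℂ) = 0 := by
  simp [fuchsIndices, h]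

lemma mem_posIndices (m : ℕ) :
    m ∈ posIndices E p B ↔ 0 < m ∧ (m : ℤ) ∈ fuchsIndices E p B := by
  simp only [posIndices, Finset.mem_image, Finset.mem_filter]
  constructor
  · rintro ⟨j, ⟨hj, h0⟩, rfl⟩
    rw [Int.toNat_of_nonneg h0.le]
    exact ⟨by omega, hj⟩
  · rintro ⟨h0, hj⟩
    exact ⟨m, ⟨hj, by omega⟩, by simp⟩

lemma zero_notMem_posIndices : 0 ∉ posIndices E p B := by
  simp [mem_posIndices]

lemma HasPainlevePropertyAt.fuchsPoly_ne_zero (hP : HasPainlevePropertyAt E p B) :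
    fuchsPoly E p B ≠ 0 := by
  intro h
  have := hP.1
  rw [h, Polynomial.degree_zero] at this
  exact absurd this (by simp)

lemma HasPainlevePropertyAt.eval_ne_zero (hP : HasPainlevePropertyAt E p B) (m : ℕ) (hm : 1 ≤ m)
    (h : m ∉ posIndices E p B) : (fuchsPoly E p B).eval (m : ℂ) ≠ 0 := by
  intro h0
  exact h ((mem_posIndices m).2 ⟨hm, (mem_fuchsIndices hP.fuchsPoly_ne_zero _).2 (by simpa using h0)⟩)

lemma reducedEq_isWeightedHomogeneous (p : ℕ) (E : MvPolynomial (Fin (n + 1)) ℂ) :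
    IsWeightedHomogeneous (poleWeight p) (reducedEq p E) (weightedTotalDegree (poleWeight p) E) :=
  weightedHomogeneousComponent_isWeightedHomogeneous _ _

lemma laurentOf_eq_zero_iff (p : ℕ) (v : PowerSeries ℂ) : laurentOf p v = 0 ↔ v = 0 := by
  have : laurentOf p 0 = 0 := by simp [laurentOf]
  rw [← this, (laurentOf_injective p).eq_iff]

lemma IsPoleBranch.eval_leadingJet (h : IsPoleBranch E p B) :
    eval (leadingJet p B) (reducedEq p E) = 0 := by
  have h1 : HahnSeries.single (-(p : ℤ)) B = laurentOf p (PowerSeries.C B) := by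
    simp [laurentOf, HahnSeries.ofPowerSeries_C, HahnSeries.C_apply]
  have h2 := h.2.2
  rw [h1, evalSeries_laurentOf p (reducedEq_isWeightedHomogeneous p E),
    laurentOf_eq_zero_iff] at h2
  have h3 := constantCoeff_substSeries p B (reducedEq p E) (PowerSeries.C B) (by simp)
  rw [h2] at h3
  simpa using h3.symm

lemma isExpansion_reducedEq_iff (y : LaurentSeries ℂ) :
    IsExpansion (reducedEq p E) p B y ↔ ∃ v, laurentOf p v = y ∧ PowerSeries.coeff 0 v = B ∧
      substSeries p (reducedEq p E) v = 0 := by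
  constructor
  · rintro ⟨h1, h2, h3⟩
    obtain ⟨v, rfl⟩ := exists_laurentOf_eq p y h3
    refine ⟨v, rfl, ?_, ?_⟩
    · rw [← coeff_laurentOf p, ← h2]; simp
    · rwa [evalSeries_laurentOf p (reducedEq_isWeightedHomogeneous p E),
        laurentOf_eq_zero_iff] at h1
  · rintro ⟨v, rfl, h1, h2⟩
    refine ⟨?_, ?_, coeff_laurentOf_of_lt p v⟩
    · rwa [evalSeries_laurentOf p (reducedEq_isWeightedHomogeneous p E),
        laurentOf_eq_zero_iff]
    · have := coeff_laurentOf p v 0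
      rw [h1] at this
      simpa using this

lemma HasPainlevePropertyAt.unique (hP : HasPainlevePropertyAt E p B)
    {v v' : PowerSeries ℂ} (hv : PowerSeries.coeff 0 v = B) (hv' : PowerSeries.coeff 0 v' = B)
    (h : substSeries p (reducedEq p E) v = 0) (h' : substSeries p (reducedEq p E) v' = 0)
    (hJ : ∀ j ∈ posIndices E p B, PowerSeries.coeff j v = PowerSeries.coeff j v') : v = v' :=
  IsPartialSolution.unique (isRecursive_substSeries p B (reducedEq p E)) hP.eval_ne_zero
    ⟨by simpa using hv, by simp [h]⟩ ⟨by simpa using hv', by simp [h']⟩ hJ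

/-- The coefficients at the positive Fuchs indices are arbitrary for the reduced equation. -/
lemma HasPainlevePropertyAt.exists_solution (hP : HasPainlevePropertyAt E p B) (b : ℕ → ℂ) :
    ∃ v : PowerSeries ℂ, PowerSeries.coeff 0 v = B ∧ substSeries p (reducedEq p E) v = 0 ∧
      ∀ j ∈ posIndices E p B, PowerSeries.coeff j v = b j := by
  set D := weightedTotalDegree (poleWeight p) E with hD
  -- The deformation parameter is the indeterminate of `ℂ[c]`, so the coefficients of `v`, and the
  -- unsolved equations at the resonances, are polynomials in `c`.
  obtain ⟨v, ⟨hv0, hv⟩, hvb⟩ := exists_isPartialSolution zero_notMem_posIndices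
    (isRecursive_deformedSubst p B E D (Polynomial.X : Polynomial ℂ)) hP.eval_ne_zero
    (fun j => Polynomial.C (b j))
  have hmap0 : ∀ c : ℂ, PowerSeries.coeff 0
      (PowerSeries.map ((Polynomial.aeval c : Polynomial ℂ →ₐ[ℂ] ℂ) : Polynomial ℂ →+* ℂ) v) =
        B := by
    intro c
    rw [PowerSeries.coeff_map, hv0]
    simp
  have hmapJ : ∀ c : ℂ, ∀ j ∈ posIndices E p B, PowerSeries.coeff j
      (PowerSeries.map ((Polynomial.aeval c : Polynomial ℂ →ₐ[ℂ] ℂ) : Polynomial ℂ →+* ℂ) v) =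
        b j := by
    intro c j hj
    rw [PowerSeries.coeff_map, hvb j hj]
    simp
  have hne : ∀ c : ℂ, c ≠ 0 → deformedSubst p E D c
      (PowerSeries.map ((Polynomial.aeval c : Polynomial ℂ →ₐ[ℂ] ℂ) : Polynomial ℂ →+* ℂ) v) =
        0 := by
    intro c hc
    -- Rescaling by `c` multiplies the `j`-th coefficient by `c^j`; the factor `(c^j)⁻¹`
    -- compensates, so that the rescaled solution has coefficients `b j`.
    obtain ⟨y, ⟨hy, hyB, hy0⟩, hyJ⟩ := hP.2.2 fun j => (c ^ (j : ℕ))⁻¹ * b j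
    obtain ⟨u, rfl⟩ := exists_laurentOf_eq p y hy0
    rw [evalSeries_laurentOf_eq_deformedSubst, laurentOf_eq_zero_iff] at hy
    have hu : deformedSubst p E D c (PowerSeries.rescale c u) = 0 := by
      have := rescale_deformedSubst c 1 p E D u
      rw [mul_one, hy, map_zero] at this
      exact this.symm
    have heq : PowerSeries.rescale c u = PowerSeries.map
        ((Polynomial.aeval c : Polynomial ℂ →ₐ[ℂ] ℂ) : Polynomial ℂ →+* ℂ) v := by
      refine IsPartialSolution.unique (isRecursive_deformedSubst p B E D c) hP.eval_ne_zero
        ⟨?_, by simp [hu]⟩ ⟨by simpa using hmap0 c, fun m hm hJ => ?_⟩ fun j hj => ?_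
      · have := coeff_laurentOf p u 0
        simp only [Nat.cast_zero, zero_sub] at this
        rw [PowerSeries.coeff_rescale, ← this, hyB]
        simp
      · have := map_deformedSubst (Polynomial.aeval c : Polynomial ℂ →ₐ[ℂ] ℂ) p E D
          Polynomial.X v
        rw [Polynomial.aeval_X] at this
        rw [← this, PowerSeries.coeff_map, hv m hm hJ, map_zero]
      · rw [hmapJ c j hj, PowerSeries.coeff_rescale, ← coeff_laurentOf p, hyJ ⟨j, hj⟩,
          mul_inv_cancel_left₀ (pow_ne_zero _ hc)]
    rw [← heq, hu]
  -- Each coefficient is a polynomial in `c` vanishing at all `c ≠ 0`, hence zero. This covers the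
  -- resonances, and permits setting `c = 0`.
  have hzero : deformedSubst p E D Polynomial.X v = 0 := by
    ext1 m
    rw [map_zero]
    refine Polynomial.eq_zero_of_infinite_isRoot _ (Set.Infinite.mono ?_
      (Set.finite_singleton (0 : ℂ)).infinite_compl)
    intro c hc
    have := map_deformedSubst (Polynomial.aeval c : Polynomial ℂ →ₐ[ℂ] ℂ) p E D Polynomial.X v
    rw [Polynomial.aeval_X, hne c hc] at this
    have := congrArg (PowerSeries.coeff m) this
    rw [PowerSeries.coeff_map, map_zero] at this
    simpa [Polynomial.coe_aeval_eq_eval] using this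
  refine ⟨_, hmap0 0, ?_, hmapJ 0⟩
  have := map_deformedSubst (Polynomial.aeval (0 : ℂ) : Polynomial ℂ →ₐ[ℂ] ℂ) p E D
    Polynomial.X v
  rw [hzero, map_zero, Polynomial.aeval_X, deformedSubst_zero] at this
  exact this.symm

lemma HasPainlevePropertyAt.existsUnique_isExpansion (hP : HasPainlevePropertyAt E p B)
    (a : posIndices E p B → ℂ) :
    ∃! y : LaurentSeries ℂ, IsExpansion (reducedEq p E) p B y ∧
      ∀ j : posIndices E p B, y.coeff ((j : ℤ) - p) = a j := by
  classical
  obtain ⟨v, h0, hv, hJ⟩ := hP.exists_solution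
    fun j => if h : j ∈ posIndices E p B then a ⟨j, h⟩ else 0
  refine ⟨laurentOf p v, ⟨(isExpansion_reducedEq_iff _).2 ⟨v, rfl, h0, hv⟩, fun j => ?_⟩, ?_⟩
  · have := coeff_laurentOf p v j
    rw [this, hJ j j.2, dif_pos j.2]
  · rintro y ⟨hy, hya⟩
    obtain ⟨v', rfl, h0', hv'⟩ := (isExpansion_reducedEq_iff _).1 hy
    congr 1
    refine hP.unique h0' h0 hv' hv fun j hj => ?_
    rw [hJ j hj, dif_pos hj, ← hya ⟨j, hj⟩]
    exact (coeff_laurentOf p v' j).symm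

/-! ### Pole-order components of first integrals -/

section WeightedHomogeneous

variable {σ R : Type*} [CommRing R] {w : σ → ℕ}

lemma component_mul {f : MvPolynomial σ R} {a : ℕ} (hf : IsWeightedHomogeneous w f a)
    (g : MvPolynomial σ R) (m : ℕ) :
    weightedHomogeneousComponent w m (f * g) =
      if a ≤ m then f * weightedHomogeneousComponent w (m - a) g else 0 := by
  set d := max (weightedTotalDegree w g) m
  conv_lhs => rw [← sum_range_component g (le_max_left _ m : _ ≤ d), Finset.mul_sum, map_sum]
  have h : ∀ i, IsWeightedHomogeneous w (f * weightedHomogeneousComponent w i g) (a + i) :=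
    fun i => hf.mul (weightedHomogeneousComponent_isWeightedHomogeneous _ _)
  split_ifs with ham
  · rw [Finset.sum_eq_single (m - a)]
    · have := (h (m - a)).weightedHomogeneousComponent_same
      rwa [Nat.add_sub_cancel' ham] at this
    · intro i _ hi
      exact (h i).weightedHomogeneousComponent_ne _ (by omega)
    · intro hi
      exact absurd (Finset.mem_range.2 (by omega)) hi
  · exact Finset.sum_eq_zero fun i _ => (h i).weightedHomogeneousComponent_ne _ (by omega)

lemma IsWeightedHomogeneous.pderiv_eq_zero {f : MvPolynomial σ R} {M : ℕ}
    (hf : IsWeightedHomogeneous w f M) {i : σ} (hi : M < w i) : pderiv i f = 0 := by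
  classical
  refine pderiv_eq_zero_of_notMem_vars fun h => ?_
  obtain ⟨d, hd, hdi⟩ := (mem_vars_iff_mem_support i).1 h
  have h1 := hf (mem_support_iff.1 hd)
  have h2 : w i ≤ Finsupp.weight w d := Finsupp.le_weight_of_ne_zero' w (Finsupp.mem_support_iff.1 hdi)
  omega

lemma IsWeightedHomogeneous.exists_pderiv {f : MvPolynomial σ R} {M : ℕ}
    (hf : IsWeightedHomogeneous w f M) (i : σ) :
    ∃ M', IsWeightedHomogeneous w (pderiv i f) M' := by
  rcases lt_or_ge M (w i) with h | h
  · exact ⟨0, by rw [pderiv_eq_zero hf h]; exact isWeightedHomogeneous_zero _ _ _⟩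
  · exact ⟨M - w i, hf.pderiv (Nat.sub_add_cancel h)⟩

lemma IsWeightedHomogeneous.rename' {τ : Type*} {w' : τ → ℕ} {e : σ → τ}
    (he : ∀ i, w' (e i) = w i) {f : MvPolynomial σ R} {M : ℕ}
    (hf : IsWeightedHomogeneous w f M) : IsWeightedHomogeneous w' (rename e f) M := by
  intro d hd
  obtain ⟨u, rfl, hu⟩ := coeff_rename_ne_zero e f d hd
  rw [← hf hu, Finsupp.weight_apply, Finsupp.weight_apply, Finsupp.sum_mapDomain_index]
  · simp [he]
  · simp
  · simp [add_mul]

end WeightedHomogeneous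

lemma totalDeriv_isWeightedHomogeneous {P : MvPolynomial (Fin n) ℂ} {M : ℕ}
    (hP : IsWeightedHomogeneous (poleWeight p) P M) :
    IsWeightedHomogeneous (poleWeight p) (totalDeriv P) (M + 1) := by
  refine IsWeightedHomogeneous.sum _ _ _ fun k _ => ?_
  rcases lt_or_ge M (poleWeight p k) with h | h
  · rw [IsWeightedHomogeneous.pderiv_eq_zero hP h, map_zero, mul_zero]
    exact isWeightedHomogeneous_zero _ _ _
  · have h1 : IsWeightedHomogeneous (poleWeight p) (rename Fin.castSucc (pderiv k P))
        (M - poleWeight p k) :=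
      IsWeightedHomogeneous.rename' (fun i => rfl) (hP.pderiv (Nat.sub_add_cancel h))
    convert! (isWeightedHomogeneous_X ℂ (poleWeight p) k.succ).mul h1 using 1
    simp only [poleWeight, Fin.val_succ] at h ⊢
    omega

lemma totalDeriv_sum {ι : Type*} (s : Finset ι) (f : ι → MvPolynomial (Fin n) ℂ) :
    totalDeriv (∑ i ∈ s, f i) = ∑ i ∈ s, totalDeriv (f i) := by
  simp only [totalDeriv, map_sum, Finset.mul_sum]
  exact Finset.sum_comm

lemma component_totalDeriv (P : MvPolynomial (Fin n) ℂ) (M : ℕ) :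
    weightedHomogeneousComponent (poleWeight p) (M + 1) (totalDeriv P) =
      totalDeriv (weightedHomogeneousComponent (poleWeight p) M P) := by
  set d := max (weightedTotalDegree (poleWeight p) P) M
  conv_lhs => rw [← sum_range_component P (le_max_left _ M : _ ≤ d), totalDeriv_sum, map_sum]
  have h : ∀ i, IsWeightedHomogeneous (poleWeight p)
      (totalDeriv (weightedHomogeneousComponent (poleWeight p) i P)) (i + 1) :=
    fun i => totalDeriv_isWeightedHomogeneous
      (weightedHomogeneousComponent_isWeightedHomogeneous _ _)
  rw [Finset.sum_eq_single M]
  · exact (h M).weightedHomogeneousComponent_same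
  · intro i _ hi
    exact (h i).weightedHomogeneousComponent_ne _ (by omega)
  · intro hi
    exact absurd (Finset.mem_range.2 (by omega)) hi

/-- The members of a given pole order of a first integral form a first integral. -/
lemma IsFirstIntegral.component {P : MvPolynomial (Fin n) ℂ}
    (h : IsFirstIntegral (reducedEq p E) P) (M : ℕ) :
    IsFirstIntegral (reducedEq p E) (weightedHomogeneousComponent (poleWeight p) M P) := by
  obtain ⟨N, Q, hQ⟩ := h
  obtain ⟨s, hs⟩ := IsWeightedHomogeneous.exists_pderiv (reducedEq_isWeightedHomogeneous p E)
    (Fin.last n)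
  have hs := hs.pow N
  have h1 := congrArg (weightedHomogeneousComponent (poleWeight p) (N • s + (M + 1))) hQ
  rw [component_mul hs, if_pos (by omega), Nat.add_sub_cancel_left, component_totalDeriv,
    mul_comm Q, component_mul (reducedEq_isWeightedHomogeneous p E)] at h1
  -- If the chosen weight is below that of the reduced equation, the right side has no component
  -- there and the multiplier is 0.
  split_ifs at h1
  · exact ⟨N, _, by rw [h1, mul_comm]⟩
  · exact ⟨N, 0, by rw [h1, zero_mul]⟩

/-! ### The derivation `x d/dx` and constancy along solutions -/

section Euler

variable {A : Type*} [CommRing A] [Algebra ℂ A]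

/-- The derivation `x d/dx`. -/
def eulerDeriv (A : Type*) [CommRing A] [Algebra ℂ A] : Derivation ℂ (PowerSeries A) (PowerSeries A) :=
  (PowerSeries.X : PowerSeries A) • (PowerSeries.derivative A).restrictScalars ℂ

lemma coeff_eulerDeriv (f : PowerSeries A) (m : ℕ) :
    PowerSeries.coeff m (eulerDeriv A f) = m * PowerSeries.coeff m f := by
  have h : eulerDeriv A f = PowerSeries.X * PowerSeries.derivative A f := rfl
  rw [h]
  cases m with
  | zero => simp
  | succ m => rw [PowerSeries.coeff_succ_X_mul, PowerSeries.coeff_derivative]; push_cast; ring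

lemma eulerDeriv_jetSeries (p k : ℕ) (v : PowerSeries A) :
    eulerDeriv A (jetSeries p k v) =
      jetSeries p (k + 1) v + ((p + k : ℕ) : PowerSeries A) * jetSeries p k v := by
  ext m
  have h : ((p + k : ℕ) : PowerSeries A) = PowerSeries.C ((p + k : ℕ) : A) := by simp
  rw [coeff_eulerDeriv, map_add, h, PowerSeries.coeff_C_mul, coeff_jetSeries, coeff_jetSeries,
    fall_succ, Algebra.smul_def, Algebra.smul_def, map_mul]
  simp
  ring

lemma substSeries_totalDeriv_eq_sum (p : ℕ) (P : MvPolynomial (Fin n) ℂ) (v : PowerSeries A) :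
    substSeries p (totalDeriv P) v =
      ∑ k : Fin n, substSeries p (pderiv k P) v * jetSeries p (k + 1) v := by
  simp only [substSeries, totalDeriv, map_sum, map_mul, aeval_X, aeval_rename]
  refine Finset.sum_congr rfl fun k _ => ?_
  rw [mul_comm]
  rfl

/-- Differentiating `x^(-M) P[v]` along the jet gives the total derivative; the factor `x^(-M)`
accounts for the term with `M`, through Euler's identity with weights `p + k`. No equation for `v`
is needed. -/
lemma eulerDeriv_substSeries {P : MvPolynomial (Fin n) ℂ} {M : ℕ}
    (hP : IsWeightedHomogeneous (poleWeight p) P M) (v : PowerSeries A) :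
    eulerDeriv A (substSeries p P v) =
      substSeries p (totalDeriv P) v + (M : PowerSeries A) * substSeries p P v := by
  have h1 := congrArg (fun F => substSeries p F v) hP.sum_weight_X_mul_pderiv
  simp only [substSeries, map_sum, nsmul_eq_mul, map_mul, map_natCast, aeval_X] at h1
  rw [substSeries_totalDeriv_eq_sum]
  simp only [substSeries]
  rw [← h1, derivation_aeval, ← Finset.sum_add_distrib]
  refine Finset.sum_congr rfl fun k _ => ?_
  rw [eulerDeriv_jetSeries, poleWeight]
  ring

end Euler

/-- Only the `yₙ` term of the Fuchs polynomial can reach degree `n`. This makes the denominators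
allowed in a first integral harmless near the branch. -/
lemma HasPainlevePropertyAt.eval_pderiv_ne_zero (hP : HasPainlevePropertyAt E p B) :
    eval (leadingJet p B) (pderiv (Fin.last n) (reducedEq p E)) ≠ 0 := by
  intro h
  have h1 := hP.1
  rw [fuchsPoly, linearization, Fin.sum_univ_castSucc, h, map_zero, zero_mul, add_zero] at h1
  refine absurd h1 (ne_of_lt ?_)
  refine lt_of_le_of_lt (Polynomial.degree_sum_le _ _) ?_
  rw [Finset.sup_lt_iff (by exact WithBot.bot_lt_coe n)]
  intro k _
  refine lt_of_le_of_lt Polynomial.degree_le_natDegree ?_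
  refine lt_of_le_of_lt (Nat.cast_le.2 (Polynomial.natDegree_C_mul_le _ _)) ?_
  rw [Polynomial.natDegree_comp, Polynomial.natDegree_X_sub_C, mul_one,
    descPochhammer_natDegree]
  exact_mod_cast k.2

/-- A weighted homogeneous first integral is constant along a Laurent solution. -/
lemma HasPainlevePropertyAt.coeff_substSeries_eq_zero (hE : HasPainlevePropertyAt E p B)
    {P : MvPolynomial (Fin n) ℂ} (h : IsFirstIntegral (reducedEq p E) P) {M : ℕ}
    (hP : IsWeightedHomogeneous (poleWeight p) P M) {v : PowerSeries ℂ}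
    (hv : PowerSeries.coeff 0 v = B) (hsol : substSeries p (reducedEq p E) v = 0)
    {m : ℕ} (hm : m ≠ M) : PowerSeries.coeff m (substSeries p P v) = 0 := by
  obtain ⟨N, Q, hQ⟩ := h
  have h1 := congrArg (fun F => substSeries p F v) hQ
  have h2 : substSeries p (pderiv (Fin.last n) (reducedEq p E)) v ^ N *
      substSeries p (totalDeriv P) v = substSeries p Q v * substSeries p (reducedEq p E) v := by
    simpa only [substSeries, map_mul, map_pow] using h1
  rw [hsol, mul_zero] at h2
  have h3 : substSeries p (pderiv (Fin.last n) (reducedEq p E)) v ≠ 0 := by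
    intro h0
    have h4 := constantCoeff_substSeries p B (pderiv (Fin.last n) (reducedEq p E)) v
      (by simpa using hv)
    rw [h0, map_zero] at h4
    exact hE.eval_pderiv_ne_zero (by simpa using h4.symm)
  have h4 := (mul_eq_zero.1 h2).resolve_left (pow_ne_zero _ h3)
  have h5 := congrArg (PowerSeries.coeff m) (eulerDeriv_substSeries hP v)
  have h : (M : PowerSeries ℂ) = PowerSeries.C (M : ℂ) := by simp
  rw [h4, zero_add, coeff_eulerDeriv, h, PowerSeries.coeff_C_mul, ← sub_eq_zero, ← sub_mul] at h5
  exact (mul_eq_zero.1 h5).resolve_left (sub_ne_zero.2 (by exact_mod_cast hm))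

lemma coeff_add_mul_of_forall_lt {A : Type*} [CommRing A] {f g : PowerSeries A} {m r : ℕ}
    (hf : ∀ i < m, PowerSeries.coeff i f = 0) (hg : ∀ i < r, PowerSeries.coeff i g = 0) :
    PowerSeries.coeff (m + r) (f * g) = PowerSeries.coeff m f * PowerSeries.coeff r g := by
  obtain ⟨f', rfl⟩ := PowerSeries.X_pow_dvd_iff.2 hf
  obtain ⟨g', rfl⟩ := PowerSeries.X_pow_dvd_iff.2 hg
  rw [mul_mul_mul_comm, ← pow_add]
  simp [PowerSeries.coeff_X_pow_mul']

/-! ### Graded coefficients and differentiation in parameters -/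

section GradedSeries

variable {A : Type*} [CommRing A] [Algebra ℂ A]

/-- The power series whose coefficients at `x ^ m` lie in the `m`-th member of a graded family. -/
def gradedSeries (H : ℕ → Submodule ℂ A) [SetLike.GradedMonoid H] :
    Subalgebra ℂ (PowerSeries A) where
  carrier := {f | ∀ m, PowerSeries.coeff m f ∈ H m}
  mul_mem' {f g} hf hg m := by
    rw [PowerSeries.coeff_mul]
    refine Submodule.sum_mem _ fun x hx => ?_
    rw [← Finset.HasAntidiagonal.mem_antidiagonal.1 hx]
    exact SetLike.mul_mem_graded (hf _) (hg _)
  add_mem' {f g} hf hg m := by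
    rw [map_add]
    exact Submodule.add_mem _ (hf m) (hg m)
  algebraMap_mem' c m := by
    rw [PowerSeries.algebraMap_apply, PowerSeries.coeff_C]
    split_ifs with h
    · rw [h, Algebra.algebraMap_eq_smul_one]
      exact Submodule.smul_mem _ _ (SetLike.one_mem_graded H)
    · exact Submodule.zero_mem _

lemma substSeries_mem_gradedSeries {H : ℕ → Submodule ℂ A} [SetLike.GradedMonoid H] (p : ℕ)
    {l : ℕ} (F : MvPolynomial (Fin l) ℂ) {v : PowerSeries A} (hv : v ∈ gradedSeries H) :
    substSeries p F v ∈ gradedSeries H := by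
  induction F using MvPolynomial.induction_on with
  | C c => simp only [substSeries, aeval_C]; exact Subalgebra.algebraMap_mem _ c
  | add f g hf hg => simp only [substSeries, map_add] at hf hg ⊢; exact Subalgebra.add_mem _ hf hg
  | mul_X f i hf =>
    simp only [substSeries, map_mul, aeval_X] at hf ⊢
    refine Subalgebra.mul_mem _ hf fun m => ?_
    rw [coeff_jetSeries]
    exact Submodule.smul_mem _ _ (hv m)

/-- The constant grading lets the same closure argument show that coefficients of a substitution
stay in a subalgebra, such as the polynomials in the `a_j` with `j < M`. -/
instance gradedMonoid_const (S : Subalgebra ℂ A) :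
    SetLike.GradedMonoid (fun _ : ℕ => Subalgebra.toSubmodule S) where
  one_mem := S.one_mem
  mul_mem _ _ _ _ hx hy := S.mul_mem hx hy

/-- A derivation acting on the coefficients of power series. -/
def coeffDeriv (D : Derivation ℂ A A) : Derivation ℂ (PowerSeries A) (PowerSeries A) :=
  Derivation.mk'
    { toFun := fun f => PowerSeries.mk fun m => D (PowerSeries.coeff m f)
      map_add' := fun f g => by ext; simp
      map_smul' := fun c f => by ext; simp }
    fun f g => by
      ext m
      simp only [LinearMap.coe_mk, AddHom.coe_mk, PowerSeries.coeff_mk, PowerSeries.coeff_mul,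
        map_sum, Derivation.leibniz, smul_eq_mul, map_add, Finset.sum_add_distrib]
      congr 1
      exact (Finset.Nat.sum_antidiagonal_swap (f := fun x : ℕ × ℕ =>
        PowerSeries.coeff x.1 g * D (PowerSeries.coeff x.2 f)))

@[simp] lemma coeff_coeffDeriv (D : Derivation ℂ A A) (f : PowerSeries A) (m : ℕ) :
    PowerSeries.coeff m (coeffDeriv D f) = D (PowerSeries.coeff m f) := by
  simp [coeffDeriv]

end GradedSeries

/-! ### Independence of the jets at distinct Fuchs indices -/

/-- The matrix of the falling factorials `fall p k (s i)`. -/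
def fallMatrix (p : ℕ) {n : ℕ} (s : Fin n → ℤ) : Matrix (Fin n) (Fin n) ℂ :=
  Matrix.of fun i k => fall p k (s i)

/-- The columns are values of monic polynomials of degrees `0, …, n-1`, so the determinant is the
Vandermonde determinant of the distinct points `s i - p`. -/
lemma det_fallMatrix_ne_zero (p : ℕ) {n : ℕ} {s : Fin n → ℤ} (hs : Function.Injective s) :
    (fallMatrix p s).det ≠ 0 := by
  have h : fallMatrix p s = Matrix.of fun i k : Fin n =>
      (descPochhammer ℂ (k : ℕ)).eval ((s i : ℂ) - p) := rfl
  rw [h, ← Matrix.det_eval_matrixOfPolynomials_eq_det_vandermonde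
    (fun i => ((s i : ℂ) - p)) (fun k : Fin n => descPochhammer ℂ (k : ℕ))
    (fun k => descPochhammer_natDegree ℂ k) (fun k => monic_descPochhammer ℂ k),
    Matrix.det_vandermonde_ne_zero_iff]
  intro i j hij
  exact hs (by exact_mod_cast sub_left_injective hij)

lemma eq_zero_of_sum_fall_smul {A : Type*} [CommRing A] [IsDomain A] [Algebra ℂ A] (p : ℕ) {n : ℕ}
    {s : Fin n → ℤ} (hs : Function.Injective s) {w : Fin n → A}
    (h : ∀ i, ∑ k : Fin n, fall p k (s i) • w k = 0) : w = 0 := by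
  refine Matrix.eq_zero_of_mulVec_eq_zero (M := (fallMatrix p s).map (algebraMap ℂ A)) ?_ ?_
  · have := RingHom.map_det (algebraMap ℂ A) (fallMatrix p s)
    rw [RingHom.mapMatrix_apply] at this
    rw [← this, map_ne_zero]
    exact det_fallMatrix_ne_zero p hs
  · ext i
    rw [Pi.zero_apply, ← h i]
    simp [Matrix.mulVec, dotProduct, fallMatrix, Algebra.smul_def]

/-! ### The general Laurent solution -/

/-- The weight of the coefficient at a positive Fuchs index. -/
abbrev indexWeight (J : Finset ℕ) (j : J) : ℕ := j

/-- A Laurent solution whose coefficients at the positions in `J` are variables. -/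
structure IsGeneralSolution (E : MvPolynomial (Fin (n + 1)) ℂ) (p : ℕ) (B : ℂ)
    (V : PowerSeries (MvPolynomial (posIndices E p B) ℂ)) : Prop where
  coeff_zero : PowerSeries.coeff 0 V = C B
  coeff_index : ∀ j : posIndices E p B, PowerSeries.coeff j V = X j
  homogeneous : ∀ m, IsWeightedHomogeneous (indexWeight (posIndices E p B))
    (PowerSeries.coeff m V) m
  map_eq : ∀ v : PowerSeries ℂ, PowerSeries.coeff 0 v = B →
    substSeries p (reducedEq p E) v = 0 →
    PowerSeries.map ((aeval fun j : posIndices E p B => PowerSeries.coeff (j : ℕ) v :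
      MvPolynomial (posIndices E p B) ℂ →ₐ[ℂ] ℂ) : MvPolynomial (posIndices E p B) ℂ →+* ℂ) V = v

instance gradedMonoid_weighted (J : Finset ℕ) : SetLike.GradedMonoid
    (fun m : ℕ => weightedHomogeneousSubmodule ℂ (indexWeight J) m) :=
  WeightedHomogeneousSubmodule.gradedMonoid

/-- A partial solution over the polynomial ring suffices: by uniqueness of the recursion, it
specializes to every true solution. -/
lemma HasPainlevePropertyAt.exists_isGeneralSolution (hP : HasPainlevePropertyAt E p B) :
    ∃ V, IsGeneralSolution E p B V := by
  classical
  obtain ⟨V, hV, hVb⟩ := exists_isPartialSolution zero_notMem_posIndices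
    (isRecursive_substSeries (A := MvPolynomial (posIndices E p B) ℂ) p B (reducedEq p E))
    hP.eval_ne_zero (fun j => if h : j ∈ posIndices E p B then X ⟨j, h⟩ else 0)
  have hX : ∀ j : posIndices E p B, PowerSeries.coeff j V = X j := fun j => by
    rw [hVb j j.2, dif_pos j.2]
  refine ⟨V, hV.1, hX, fun m => ?_, fun v hv hsol => ?_⟩
  · induction m using Nat.strong_induction_on with
    | _ m ih =>
      rcases Nat.eq_zero_or_pos m with rfl | hm
      · rw [hV.1]
        exact isWeightedHomogeneous_C _ _
      by_cases hJ : m ∈ posIndices E p B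
      · rw [hX ⟨m, hJ⟩]
        exact isWeightedHomogeneous_X ℂ _ _
      -- Truncating before `m` keeps all coefficients homogeneous, and comparison with `V` isolates
      -- the one at `m`, with `Λ m` invertible.
      set V' : PowerSeries (MvPolynomial (posIndices E p B) ℂ) :=
        PowerSeries.mk fun i => if i < m then PowerSeries.coeff i V else 0 with hV'
      have hmem : V' ∈ gradedSeries
          (fun m : ℕ => weightedHomogeneousSubmodule ℂ (indexWeight (posIndices E p B)) m) := by
        intro i
        rw [hV', PowerSeries.coeff_mk]
        split_ifs with hi
        · exact ih i hi
        · exact Submodule.zero_mem _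
      have h1 := coeff_substSeries_sub p B hm (reducedEq p E) V V' hV.1
        (fun i hi => by simp [hV', hi])
      rw [hV.2 m hm hJ, zero_sub, hV', PowerSeries.coeff_mk, if_neg (lt_irrefl m), sub_zero,
        ← hV'] at h1
      have hne : (linearization (reducedEq p E) p B).eval (m : ℂ) ≠ 0 :=
        hP.eval_ne_zero m hm hJ
      rw [← inv_smul_eq_iff₀ hne] at h1
      rw [← h1, ← mem_weightedHomogeneousSubmodule]
      exact Submodule.smul_mem _ _ (Submodule.neg_mem _
        (substSeries_mem_gradedSeries p (reducedEq p E) hmem m))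
  · refine IsPartialSolution.unique (isRecursive_substSeries p B (reducedEq p E)) hP.eval_ne_zero
      ⟨?_, fun m hm hJ => ?_⟩ ⟨by simpa using hv, by simp [hsol]⟩ fun j hj => ?_
    · rw [PowerSeries.coeff_map, hV.1]
      simp
    · rw [← map_substSeries, PowerSeries.coeff_map, hV.2 m hm hJ, map_zero]
    · rw [PowerSeries.coeff_map, hX ⟨j, hj⟩]
      simp

lemma eq_C_of_isWeightedHomogeneous_zero (hp : 1 ≤ p) {l : ℕ} {P : MvPolynomial (Fin l) ℂ}
    (hP : IsWeightedHomogeneous (poleWeight p) P 0) : P = C (coeff 0 P) := by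
  have h := hP.weightedHomogeneousComponent_same
  rw [weightedHomogeneousComponent_zero _ fun i => by simp only [poleWeight]; omega] at h
  exact h.symm

lemma HasPainlevePropertyAt.exists_enumeration (hP : HasPainlevePropertyAt E p B) :
    ∃ s : Fin n → ℤ, Function.Injective s ∧ ∀ j, j ∈ fuchsIndices E p B ↔ ∃ i, s i = j := by
  let e := (fuchsIndices E p B).equivFinOfCardEq hP.2.1
  refine ⟨fun i => e.symm i, fun i i' h => e.symm.injective (Subtype.ext h), fun j => ⟨fun hj =>
    ⟨e ⟨j, hj⟩, by simp⟩, ?_⟩⟩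
  rintro ⟨i, rfl⟩
  exact (e.symm i).2

/-- At a general branch no differential polynomial of order less than `n` vanishes on all Laurent
solutions. -/
lemma IsGeneralSolution.eq_zero_of_substSeries_eq_zero (hp : 1 ≤ p) (hB : B ≠ 0)
    (hP : HasPainlevePropertyAt E p B) (hgen : IsGeneralBranch E p B)
    {V : PowerSeries (MvPolynomial (posIndices E p B) ℂ)} (hV : IsGeneralSolution E p B V)
    {P : MvPolynomial (Fin n) ℂ} {M : ℕ} (hM : IsWeightedHomogeneous (poleWeight p) P M)
    (h : substSeries p P V = 0) : P = 0 := by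
  obtain ⟨s, hs, hsT⟩ := hP.exists_enumeration
  induction M using Nat.strong_induction_on generalizing P with
  | _ M ih =>
  -- The gradient of `P` along `V` is shown to vanish coefficient by coefficient. At the first
  -- undecided position `m`, each Fuchs index yields one equation of an invertible `n × n` system.
  have hw : ∀ m, ∀ k : Fin n, PowerSeries.coeff m (substSeries p (pderiv k P) V) = 0 := by
    intro m
    induction m using Nat.strong_induction_on with
    | _ m ihm =>
    refine fun k => congrFun (eq_zero_of_sum_fall_smul p hs (w := fun k =>
      PowerSeries.coeff m (substSeries p (pderiv k P) V)) fun i => ?_) k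
    rcases hgen (s i) ((hsT _).2 ⟨i, rfl⟩) with hi | hi
    · have h1 : substSeries p (totalDeriv P) V = 0 := by
        have := eulerDeriv_substSeries hM V
        rw [h, map_zero, mul_zero, add_zero] at this
        exact this.symm
      have h2 := congrArg (PowerSeries.coeff (m + 0)) h1
      rw [substSeries_totalDeriv_eq_sum, map_sum, map_zero] at h2
      have h3 : ∀ k : Fin n, PowerSeries.coeff (m + 0) (substSeries p (pderiv k P) V *
          jetSeries p (k + 1) V) = (-(p : ℂ) * B) •
            (fall p k (s i) • PowerSeries.coeff m (substSeries p (pderiv k P) V)) := by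
        intro k
        rw [coeff_add_mul_of_forall_lt (fun i hi => ihm i hi k) (by simp), coeff_jetSeries,
          hV.coeff_zero, Nat.cast_zero, fall_succ_zero, hi, smul_smul, smul_eq_C_mul,
          smul_eq_C_mul, ← C_mul, mul_comm]
        push_cast
        congr 2
        ring
      simp_rw [h3, ← Finset.smul_sum] at h2
      refine (smul_eq_zero.1 h2).resolve_left (mul_ne_zero (neg_ne_zero.2 ?_) hB)
      exact_mod_cast (by omega : p ≠ 0)
    · obtain ⟨j, hj⟩ := Int.eq_ofNat_of_zero_le hi.le
      have hjJ : j ∈ posIndices E p B :=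
        (mem_posIndices j).2 ⟨by omega, (hsT _).2 ⟨i, hj⟩⟩
      -- Positive index `j`: differentiate in `a_j`. By weight, `a_j` is absent from `V` before
      -- position `j`, where the coefficient is `a_j` itself.
      have h1 := derivation_aeval (coeffDeriv (pderiv (⟨j, hjJ⟩ : posIndices E p B)))
        (fun k : Fin n => jetSeries p k V) P
      have h0 : (aeval (fun k : Fin n => jetSeries p k V)) P = 0 := h
      rw [h0, map_zero] at h1
      have h2 := congrArg (PowerSeries.coeff (m + j)) h1.symm
      rw [map_sum, map_zero] at h2
      rw [← h2]
      refine Finset.sum_congr rfl fun k _ => ?_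
      change _ = PowerSeries.coeff (m + j) (substSeries p (pderiv k P) V * _)
      rw [coeff_add_mul_of_forall_lt (fun i hi => ihm i hi k)]
      · rw [coeff_coeffDeriv, coeff_jetSeries, hV.coeff_index ⟨j, hjJ⟩, Derivation.map_smul,
          pderiv_X_self, hj, mul_smul_comm, mul_one]
        rfl
      · intro i' hi'
        rw [coeff_coeffDeriv, coeff_jetSeries, Derivation.map_smul,
          IsWeightedHomogeneous.pderiv_eq_zero (hV.homogeneous i') hi', smul_zero]
  have hd : ∀ k, pderiv k P = 0 := by
    intro k
    rcases lt_or_ge M (poleWeight p k) with hk | hk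
    · exact IsWeightedHomogeneous.pderiv_eq_zero hM hk
    · refine ih (M - poleWeight p k) ?_ (hM.pderiv (Nat.sub_add_cancel hk)) ?_
      · simp only [poleWeight] at hk ⊢
        omega
      · ext1 m
        rw [hw m k, map_zero]
  have he := hM.sum_weight_X_mul_pderiv
  simp only [hd, mul_zero, smul_zero, Finset.sum_const_zero] at he
  rcases Nat.eq_zero_or_pos M with rfl | hM0
  · have hc := eq_C_of_isWeightedHomogeneous_zero hp hM
    rw [hc] at h ⊢
    simp only [substSeries, aeval_C] at h
    have h5 := congrArg (PowerSeries.coeff 0) h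
    rw [PowerSeries.algebraMap_apply, PowerSeries.coeff_zero_C, map_zero] at h5
    have h6 : coeff 0 P = 0 := by simpa using h5
    rw [h6, map_zero]
  · exact (smul_eq_zero.1 he.symm).resolve_left (by omega)

/-! ### Lowest term of a first integral at the leading jet -/

section Expansion

variable {A : Type*} [CommRing A] [Algebra ℂ A]

/-- The expansion of `F` at the leading jet in the direction `η`, as a power series in the step. -/
def expandAt (p : ℕ) (B : ℂ) {l : ℕ} (η : Fin l → A) (F : MvPolynomial (Fin l) ℂ) :
    PowerSeries A :=
  aeval (fun k => PowerSeries.C (algebraMap ℂ A (leadingJet p B k)) +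
    PowerSeries.X * PowerSeries.C (η k)) F

lemma map_expandAt {A' : Type*} [CommRing A'] [Algebra ℂ A'] (φ : A →ₐ[ℂ] A') (p : ℕ) (B : ℂ)
    {l : ℕ} (η : Fin l → A) (F : MvPolynomial (Fin l) ℂ) :
    PowerSeries.map (φ : A →+* A') (expandAt p B η F) = expandAt p B (fun k => φ (η k)) F := by
  have h : PowerSeries.map (φ : A →+* A') (expandAt p B η F) =
      PowerSeries.mapAlgHom φ (expandAt p B η F) := rfl
  rw [h, expandAt, ← AlgHom.comp_apply, comp_aeval]
  simp only [expandAt]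
  congr 2
  ext1 k
  have h2 : ∀ f, PowerSeries.mapAlgHom φ f = PowerSeries.map (φ : A →+* A') f := fun _ => rfl
  simp [h2]

lemma coeff_zero_expandAt (p : ℕ) (B : ℂ) {l : ℕ} (η : Fin l → A) (F : MvPolynomial (Fin l) ℂ) :
    PowerSeries.coeff 0 (expandAt p B η F) = algebraMap ℂ A (eval (leadingJet p B) F) := by
  rw [PowerSeries.coeff_zero_eq_constantCoeff_apply, expandAt, map_aeval, coe_eval₂Hom]
  simp only [map_add, map_mul, PowerSeries.constantCoeff_C, PowerSeries.constantCoeff_X, zero_mul,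
    add_zero]
  have h : (PowerSeries.constantCoeff (R := A)).comp (algebraMap ℂ (PowerSeries A)) =
      algebraMap ℂ A := by
    ext c
    simp [PowerSeries.algebraMap_apply]
  rw [h, eval₂_comp]
  rfl

lemma coeff_one_expandAt (p : ℕ) (B : ℂ) {l : ℕ} (η : Fin l → A) (F : MvPolynomial (Fin l) ℂ) :
    PowerSeries.coeff 1 (expandAt p B η F) =
      ∑ k, algebraMap ℂ A (eval (leadingJet p B) (pderiv k F)) * η k := by
  have h := congrArg (PowerSeries.coeff 0) (derivation_aeval
    ((PowerSeries.derivative A).restrictScalars ℂ)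
    (fun k => PowerSeries.C (algebraMap ℂ A (leadingJet p B k)) +
      PowerSeries.X * PowerSeries.C (η k)) F)
  rw [Derivation.restrictScalars_apply, PowerSeries.coeff_derivative, map_sum] at h
  simp only [Nat.cast_zero, zero_add, mul_one] at h
  rw [expandAt, h]
  refine Finset.sum_congr rfl fun k _ => ?_
  have h1 := coeff_zero_expandAt p B η (pderiv k F)
  rw [expandAt] at h1
  rw [PowerSeries.coeff_zero_eq_constantCoeff_apply] at h1 ⊢
  rw [map_mul, h1]
  simp [Derivation.leibniz]

/-- The expansion is a polynomial in the step; setting the step to 1 and translating back recovers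
`F`. -/
lemma expandAt_X_injective (p : ℕ) (B : ℂ) (l : ℕ) :
    Function.Injective (expandAt p B (X : Fin l → MvPolynomial (Fin l) ℂ)) := by
  let θ : MvPolynomial (Fin l) ℂ →ₐ[ℂ] Polynomial (MvPolynomial (Fin l) ℂ) :=
    aeval fun k => Polynomial.C (C (leadingJet p B k)) + Polynomial.X * Polynomial.C (X k)
  have h1 : ∀ F, expandAt p B (X : Fin l → MvPolynomial (Fin l) ℂ) F =
      Polynomial.coeToPowerSeries.ringHom (θ F) := by
    intro F
    rw [expandAt, map_aeval, aeval_def, coe_eval₂Hom]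
    congr 1
    · ext1 k
      simp [algebraMap_eq, PowerSeries.algebraMap_apply]
    · ext1 k
      simp only [algebraMap_eq, map_add, map_mul,
        Polynomial.coeToPowerSeries.ringHom_apply, Polynomial.coe_C, Polynomial.coe_X]
  let ψ : Polynomial (MvPolynomial (Fin l) ℂ) →ₐ[ℂ] MvPolynomial (Fin l) ℂ :=
    (aeval fun k => X k - C (leadingJet p B k)).comp
      ((Polynomial.aeval (1 : MvPolynomial (Fin l) ℂ)).restrictScalars ℂ)
  have h2 : ψ.comp θ = AlgHom.id ℂ _ := by
    ext k
    simp [ψ, θ]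
  intro F G h
  rw [h1, h1] at h
  have h3 : θ F = θ G := Polynomial.coe_injective _ h
  have h4 := congrArg ψ h3
  rw [← AlgHom.comp_apply, ← AlgHom.comp_apply, h2] at h4
  exact h4

/-- Consequently the homogeneous parts of `∂F/∂yₖ` are the derivatives of those of `F`, shifted down
by one degree. -/
lemma coeffDeriv_expandAt_X (p : ℕ) (B : ℂ) {l : ℕ} (F : MvPolynomial (Fin l) ℂ) (k : Fin l) :
    coeffDeriv (pderiv k) (expandAt p B (X : Fin l → MvPolynomial (Fin l) ℂ) F) =
      PowerSeries.X * expandAt p B (X : Fin l → MvPolynomial (Fin l) ℂ) (pderiv k F) := by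
  classical
  have hC : ∀ f : MvPolynomial (Fin l) ℂ, coeffDeriv (pderiv k) (PowerSeries.C f) =
      PowerSeries.C (pderiv k f) := by
    intro f
    ext1 m
    rw [coeff_coeffDeriv, PowerSeries.coeff_C, PowerSeries.coeff_C]
    split_ifs <;> simp
  have hX : coeffDeriv (pderiv k) (PowerSeries.X : PowerSeries (MvPolynomial (Fin l) ℂ)) = 0 := by
    ext1 m
    rw [coeff_coeffDeriv, PowerSeries.coeff_X]
    split_ifs <;> simp
  rw [expandAt, derivation_aeval, Finset.sum_eq_single k]
  · rw [map_add, Derivation.leibniz, hC, hC, hX, pderiv_X_self, algebraMap_eq, pderiv_C]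
    simp [expandAt, mul_comm]
  · intro i _ hi
    rw [map_add, Derivation.leibniz, hC, hC, hX, pderiv_X_of_ne hi, algebraMap_eq, pderiv_C]
    simp
  · simp

end Expansion

/-- Lowest terms in a relation `s ^ N * F = Q * G` with `G` of order one: the lowest term of `F`
vanishes wherever the lowest term of `G` does. -/
lemma map_coeff_eq_zero_of_pow_mul_eq {R R' : Type*} [CommRing R] [IsDomain R] [CommRing R']
    [IsDomain R'] (φ : R →+* R') {s F Q G : PowerSeries R} {N r : ℕ} (h : s ^ N * F = Q * G)
    (h0 : PowerSeries.coeff 0 G = 0) (h1 : PowerSeries.coeff 1 G ≠ 0)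
    (h1' : φ (PowerSeries.coeff 1 G) = 0) (hs : φ (PowerSeries.coeff 0 s) ≠ 0)
    (hF : ∀ i < r, PowerSeries.coeff i F = 0) : φ (PowerSeries.coeff r F) = 0 := by
  have hsF : ∀ i ≤ r, PowerSeries.coeff i (Q * G) =
      PowerSeries.coeff 0 s ^ N * PowerSeries.coeff i F := by
    intro i hi
    have := coeff_add_mul_of_forall_lt (f := s ^ N) (g := F) (m := 0) (r := i) (by simp)
      fun j hj => hF j (by omega)
    rw [zero_add, h] at this
    rw [this, PowerSeries.coeff_zero_eq_constantCoeff_apply, map_pow,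
      PowerSeries.coeff_zero_eq_constantCoeff_apply]
  have hG : ∀ i < 1, PowerSeries.coeff i G = 0 := by
    intro i hi
    rw [Nat.lt_one_iff.1 hi, h0]
  have hr : φ (PowerSeries.coeff r (Q * G)) = 0 := by
    rcases r with _ | r
    · rw [PowerSeries.coeff_zero_eq_constantCoeff_apply, map_mul,
        ← PowerSeries.coeff_zero_eq_constantCoeff_apply G, h0, mul_zero, map_zero]
    · have hQ : ∀ i < r, PowerSeries.coeff i Q = 0 := by
        intro i
        induction i using Nat.strong_induction_on with
        | _ i ih =>
          intro hi
          have := coeff_add_mul_of_forall_lt (fun j hj => ih j hj (by omega)) hG (m := i)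
          rw [hsF _ (by omega), hF _ (by omega), mul_zero] at this
          exact (mul_eq_zero.1 this.symm).resolve_right h1
      rw [coeff_add_mul_of_forall_lt hQ hG, map_mul, h1', mul_zero]
  rw [hsF r le_rfl, map_mul, map_pow] at hr
  exact (mul_eq_zero.1 hr).resolve_left (pow_ne_zero _ hs)

/-- The parametrization of the jets of `∑ tᵢ x ^ (sᵢ - p)` at `x = 1`. -/
def jetParam (p : ℕ) {n : ℕ} (s : Fin n → ℤ) (k : ℕ) : MvPolynomial (Fin n) ℂ :=
  ∑ i, C (fall p k (s i)) * X i

lemma aeval_jetParam_injective (p : ℕ) {n : ℕ} {s : Fin n → ℤ} (hs : Function.Injective s) :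
    Function.Injective (aeval fun k : Fin n => jetParam p s k :
      MvPolynomial (Fin n) ℂ →ₐ[ℂ] MvPolynomial (Fin n) ℂ) := by
  let T := fallMatrix p s
  have hT : T⁻¹ * T = 1 :=
    Matrix.nonsing_inv_mul _ (isUnit_iff_ne_zero.2 (det_fallMatrix_ne_zero p hs))
  let ψ : MvPolynomial (Fin n) ℂ →ₐ[ℂ] MvPolynomial (Fin n) ℂ :=
    aeval fun i => ∑ l, C (T⁻¹ l i) * X l
  have h : ψ.comp (aeval fun k : Fin n => jetParam p s k) = AlgHom.id ℂ _ := by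
    refine algHom_ext fun k => ?_
    simp only [AlgHom.comp_apply, aeval_X, jetParam, map_sum, map_mul, AlgHom.id_apply, ψ]
    simp only [Finset.mul_sum, algHom_C, algebraMap_eq]
    rw [Finset.sum_comm]
    have h2 : ∀ l, ∑ i, (C (fall p k (s i)) * (C (T⁻¹ l i) * X l) : MvPolynomial (Fin n) ℂ) =
        C ((T⁻¹ * T) l k) * X l := by
      intro l
      rw [Matrix.mul_apply, map_sum, Finset.sum_mul]
      refine Finset.sum_congr rfl fun i _ => ?_
      rw [C_mul]
      simp only [T, fallMatrix, Matrix.of_apply]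
      ring
    simp_rw [h2, hT, Matrix.one_apply]
    rw [Finset.sum_eq_single k] <;> simp +contextual
  intro F G hFG
  have := congrArg ψ hFG
  rw [← AlgHom.comp_apply, ← AlgHom.comp_apply, h] at this
  exact this

lemma coeff_X_mul_pderiv {σ R : Type*} [CommRing R] (f : MvPolynomial σ R) (i : σ) (d : σ →₀ ℕ) :
    coeff d (X i * pderiv i f) = d i * coeff d f := by
  classical
  induction f using MvPolynomial.induction_on' with
  | monomial u a =>
    rw [X_mul_pderiv_monomial, coeff_smul, coeff_monomial]
    split_ifs with h <;> simp [h]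
  | add f g hf hg => simp [mul_add, hf, hg]

/-- The lowest term of a first integral at the leading jet, in the coordinates given by the
Fuchs indices: only monomials of weight `M` occur, and the coordinate of the Fuchs index `-1` does
not occur. -/
lemma HasPainlevePropertyAt.exists_lowest_term (hbranch : IsPoleBranch E p B)
    (hE : HasPainlevePropertyAt E p B) {s : Fin n → ℤ} (hs : Function.Injective s)
    (hsT : ∀ j, j ∈ fuchsIndices E p B ↔ ∃ i, s i = j) {P : MvPolynomial (Fin n) ℂ}
    (hfirst : IsFirstIntegral (reducedEq p E) P) {M : ℕ}
    (hM : IsWeightedHomogeneous (poleWeight p) P M) (hP : P ≠ 0) :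
    ∃ r : ℕ, (∀ i < r, PowerSeries.coeff i (expandAt p B (X : Fin n → MvPolynomial (Fin n) ℂ) P) = 0)
      ∧ ∃ f : MvPolynomial (Fin n) ℂ, f = aeval (fun k : Fin n => jetParam p s k)
        (PowerSeries.coeff r (expandAt p B (X : Fin n → MvPolynomial (Fin n) ℂ) P)) ∧ f ≠ 0 ∧
      ∀ d ∈ f.support, (M : ℤ) = ∑ i, (d i : ℤ) * s i ∧ ∀ i, s i = -1 → d i = 0 := by
  classical
  have hne : ∃ r, PowerSeries.coeff r (expandAt p B (X : Fin n → MvPolynomial (Fin n) ℂ) P) ≠ 0 := by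
    by_contra! h
    refine hP (expandAt_X_injective p B n ?_)
    ext1 m
    rw [h m]
    simp [expandAt]
  set r := Nat.find hne with hr
  have hlow : ∀ i < r, PowerSeries.coeff i
      (expandAt p B (X : Fin n → MvPolynomial (Fin n) ℂ) P) = 0 :=
    fun i hi => not_not.1 (Nat.find_min hne hi)
  set Pr := PowerSeries.coeff r (expandAt p B (X : Fin n → MvPolynomial (Fin n) ℂ) P) with hPr
  have hPr0 : Pr ≠ 0 := Nat.find_spec hne
  set f := aeval (fun k : Fin n => jetParam p s k) Pr with hf
  refine ⟨r, hlow, f, rfl, ?_, ?_⟩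
  · intro h0
    exact hPr0 (aeval_jetParam_injective p hs (by rw [← hf, h0, map_zero]))
  -- the expansions in all directions, and the restriction to the directions `jetParam`
  let Ψ := fun F : MvPolynomial (Fin (n + 1)) ℂ =>
    expandAt p B (X : Fin (n + 1) → MvPolynomial (Fin (n + 1)) ℂ) F
  let ΨP := fun F : MvPolynomial (Fin n) ℂ =>
    expandAt p B (fun k : Fin n => (X k.castSucc : MvPolynomial (Fin (n + 1)) ℂ)) F
  let G : Fin n → PowerSeries (MvPolynomial (Fin (n + 1)) ℂ) := fun k =>
    PowerSeries.X * ΨP (pderiv k P)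
  let φ : MvPolynomial (Fin (n + 1)) ℂ →ₐ[ℂ] MvPolynomial (Fin n) ℂ :=
    aeval fun k => jetParam p s k
  have hΨP : ∀ F, ΨP F = PowerSeries.map ((rename Fin.castSucc : MvPolynomial (Fin n) ℂ →ₐ[ℂ]
      MvPolynomial (Fin (n + 1)) ℂ) : MvPolynomial (Fin n) ℂ →+* MvPolynomial (Fin (n + 1)) ℂ)
      (expandAt p B (X : Fin n → MvPolynomial (Fin n) ℂ) F) := by
    intro F
    rw [map_expandAt]
    simp [ΨP]
  have hG : ∀ k i, PowerSeries.coeff i (G k) = rename Fin.castSucc (pderiv k (PowerSeries.coeff i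
      (expandAt p B (X : Fin n → MvPolynomial (Fin n) ℂ) P))) := by
    intro k i
    have h1 : G k = PowerSeries.map ((rename Fin.castSucc : MvPolynomial (Fin n) ℂ →ₐ[ℂ]
      MvPolynomial (Fin (n + 1)) ℂ) : MvPolynomial (Fin n) ℂ →+* MvPolynomial (Fin (n + 1)) ℂ)
        (coeffDeriv (pderiv k) (expandAt p B (X : Fin n → MvPolynomial (Fin n) ℂ) P)) := by
      rw [coeffDeriv_expandAt_X, map_mul, ← hΨP, PowerSeries.map_X]
    rw [h1, PowerSeries.coeff_map, coeff_coeffDeriv]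
    rfl
  have hφr : ∀ F : MvPolynomial (Fin n) ℂ, φ (rename Fin.castSucc F) =
      aeval (fun k : Fin n => jetParam p s k) F := by
    intro F
    simp only [φ, aeval_rename]
    rfl
  have hφX : ∀ k, φ (X k) = jetParam p s k := fun k => aeval_X _ _
  have hφC : ∀ c, φ (C c) = C c := fun c => by simp [φ, algebraMap_eq]
  -- derivatives of the restriction
  have hdf : ∀ i, pderiv i f = ∑ k : Fin n,
      C (fall p k (s i)) * aeval (fun k : Fin n => jetParam p s k) (pderiv k Pr) := by
    intro i
    rw [hf, derivation_aeval]
    refine Finset.sum_congr rfl fun k _ => ?_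
    rw [mul_comm]
    congr 1
    simp only [jetParam, map_sum, pderiv_C_mul]
    rw [Finset.sum_eq_single i]
    · rw [pderiv_X_self, mul_one]
    · intro j _ hj
      rw [pderiv_X_of_ne hj, mul_zero]
    · simp
  -- lowest terms of the total derivative
  have hD : Ψ (totalDeriv P) = ∑ k : Fin n,
      (PowerSeries.C (C (leadingJet p B k.succ)) + PowerSeries.X * PowerSeries.C (X k.succ)) *
        ΨP (pderiv k P) := by
    simp only [Ψ, ΨP, totalDeriv, expandAt, map_sum, map_mul, aeval_X, aeval_rename]
    rfl
  have hMP : (M : PowerSeries (MvPolynomial (Fin (n + 1)) ℂ)) * ΨP P = ∑ k : Fin n,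
      ((p + k : ℕ) : PowerSeries (MvPolynomial (Fin (n + 1)) ℂ)) *
      ((PowerSeries.C (C (leadingJet p B k)) + PowerSeries.X * PowerSeries.C (X k.castSucc)) *
        ΨP (pderiv k P)) := by
    have h1 := congrArg ΨP hM.sum_weight_X_mul_pderiv
    simp only [ΨP, expandAt, map_sum, nsmul_eq_mul, map_mul, map_natCast, aeval_X] at h1
    simp only [ΨP, expandAt]
    rw [← h1]
    rfl
  -- Since the leading jet `c` satisfies `c_{k+1} = -(p+k) c_k`, Euler's identity removes the terms
  -- with `c` from the total derivative, leaving a degree-preserving operator acting on the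
  -- homogeneous parts of `P`.
  have hDM : Ψ (totalDeriv P) = ∑ k : Fin n,
      PowerSeries.C (X k.succ + ((p + k : ℕ) : MvPolynomial (Fin (n + 1)) ℂ) * X k.castSucc) * G k -
      PowerSeries.C (M : MvPolynomial (Fin (n + 1)) ℂ) * ΨP P := by
    rw [map_natCast, hMP, hD, eq_sub_iff_add_eq, ← Finset.sum_add_distrib]
    refine Finset.sum_congr rfl fun k _ => ?_
    have h2 : PowerSeries.C (C (leadingJet p B k.succ) : MvPolynomial (Fin (n + 1)) ℂ) =
        -((p + k : ℕ) : PowerSeries (MvPolynomial (Fin (n + 1)) ℂ)) *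
          PowerSeries.C (C (leadingJet p B k)) := by
      rw [leadingJet_succ, C_mul, map_mul]
      congr 1
      simp
    rw [h2, map_add, map_mul, map_natCast]
    simp only [G]
    ring
  have hXD : PowerSeries.X * Ψ (totalDeriv P) = ∑ k : Fin n,
      (PowerSeries.C (C (leadingJet p B k.succ)) + PowerSeries.X * PowerSeries.C (X k.succ)) *
        G k := by
    rw [hD, Finset.mul_sum]
    refine Finset.sum_congr rfl fun k _ => ?_
    simp only [G]
    ring
  have hGlow : ∀ k, ∀ i < r, PowerSeries.coeff i (G k) = 0 := by
    intro k i hi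
    rw [hG, hlow i hi, map_zero, map_zero]
  have hΨPlow : ∀ i < r, PowerSeries.coeff i (ΨP P) = 0 := by
    intro i hi
    rw [hΨP, PowerSeries.coeff_map, hlow i hi, map_zero]
  -- the relation defining first integrals
  obtain ⟨N, Q, hQ⟩ := hfirst
  have hΨQ : Ψ (pderiv (Fin.last n) (reducedEq p E)) ^ N * Ψ (totalDeriv P) =
      Ψ Q * Ψ (reducedEq p E) := by
    have := congrArg Ψ hQ
    simpa only [Ψ, expandAt, map_mul, map_pow] using this
  have hE0 : PowerSeries.coeff 0 (Ψ (reducedEq p E)) = 0 := by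
    rw [coeff_zero_expandAt, hbranch.eval_leadingJet, map_zero]
  have hE1 : PowerSeries.coeff 1 (Ψ (reducedEq p E)) ≠ 0 := by
    intro h
    rw [coeff_one_expandAt] at h
    have := congrArg (eval (Pi.single (Fin.last n) 1)) h
    simp only [map_sum, map_mul, algebraMap_eq, eval_C, eval_X, map_zero] at this
    rw [Finset.sum_eq_single (Fin.last n)] at this
    · rw [Pi.single_eq_same, mul_one] at this
      exact hE.eval_pderiv_ne_zero this
    · intro k _ hk
      rw [Pi.single_eq_of_ne hk, mul_zero]
    · simp
  -- Each direction `x^(s_i-p)` solves the linearized equation because `s_i` is a root of the Fuchs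
  -- polynomial.
  have hE1' : φ (PowerSeries.coeff 1 (Ψ (reducedEq p E))) = 0 := by
    rw [coeff_one_expandAt]
    simp only [map_sum, map_mul, algebraMap_eq, hφX, hφC, jetParam, Finset.mul_sum]
    rw [Finset.sum_comm]
    refine Finset.sum_eq_zero fun i _ => ?_
    have h1 := (mem_fuchsIndices hE.fuchsPoly_ne_zero _).1 ((hsT _).2 ⟨i, rfl⟩)
    rw [fuchsPoly, eval_linearization] at h1
    have h2 := congrArg (fun c => (C c * X i : MvPolynomial (Fin n) ℂ)) h1
    simpa only [map_sum, C_mul, Finset.sum_mul, mul_assoc, map_zero, zero_mul] using h2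
  have hS : φ (PowerSeries.coeff 0 (Ψ (pderiv (Fin.last n) (reducedEq p E)))) ≠ 0 := by
    rw [coeff_zero_expandAt, algebraMap_eq, hφC]
    exact (C_ne_zero).2 hE.eval_pderiv_ne_zero
  -- Degree `r` of the relation. On the chosen directions `η_{k+1} + (p+k) η_k = ∑ s_i t_i fall p k
  -- (s_i)`, so the operator is diagonal in the coordinates `t_i`.
  have hΦ1 : ∑ i, C (s i : ℂ) * (X i * pderiv i f) = C (M : ℂ) * f := by
    have h1 := map_coeff_eq_zero_of_pow_mul_eq (φ : MvPolynomial (Fin (n + 1)) ℂ →+*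
      MvPolynomial (Fin n) ℂ) hΨQ hE0
      hE1 hE1' hS (r := r) (fun i hi => by
        rw [hDM, map_sub, map_sum, PowerSeries.coeff_C_mul, hΨPlow i hi, mul_zero, sub_zero]
        exact Finset.sum_eq_zero fun k _ => by
          rw [PowerSeries.coeff_C_mul, hGlow k i hi, mul_zero])
    rw [hDM, map_sub, map_sum, PowerSeries.coeff_C_mul] at h1
    simp_rw [PowerSeries.coeff_C_mul, hG] at h1
    rw [hΨP, PowerSeries.coeff_map] at h1
    simp only [RingHom.coe_coe, map_sub, map_sum, map_mul, map_add, hφr, hφX, map_natCast] at h1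
    rw [sub_eq_zero, ← hPr, ← hf] at h1
    rw [map_natCast, ← h1]
    simp_rw [hdf, Finset.mul_sum]
    rw [Finset.sum_comm]
    refine Finset.sum_congr rfl fun k _ => ?_
    rw [Fin.val_succ, Fin.val_castSucc, jetParam, jetParam, Finset.mul_sum,
      ← Finset.sum_add_distrib, Finset.sum_mul]
    refine Finset.sum_congr rfl fun i _ => ?_
    rw [fall_succ, C_mul, C_sub, C_add]
    simp only [map_natCast, Nat.cast_add]
    ring
  -- One degree lower, the total derivative contributes only `∑ c_{k+1} ∂P_r/∂η_k`, the derivative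
  -- of the lowest part in the translation direction, i.e. that of the index `-1`. Multiplying by
  -- `X` shifts this to position `r`, and also covers `r = 0`.
  have hΦ2 : ∀ i, s i = -1 → pderiv i f = 0 := by
    intro i hi
    have h0 : Ψ (pderiv (Fin.last n) (reducedEq p E)) ^ N * (PowerSeries.X * Ψ (totalDeriv P)) =
        (PowerSeries.X * Ψ Q) * Ψ (reducedEq p E) := by
      rw [mul_left_comm, hΨQ, mul_assoc]
    have hcoef : ∀ k, ∀ i ≤ r, PowerSeries.coeff i
        ((PowerSeries.C (C (leadingJet p B k.succ) : MvPolynomial (Fin (n + 1)) ℂ) +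
          PowerSeries.X * PowerSeries.C (X k.succ)) * G k) =
        C (leadingJet p B k.succ) * PowerSeries.coeff i (G k) := by
      intro k i hi
      have := coeff_add_mul_of_forall_lt (m := 0) (r := i)
        (f := PowerSeries.C (C (leadingJet p B k.succ) : MvPolynomial (Fin (n + 1)) ℂ) +
          PowerSeries.X * PowerSeries.C (X k.succ)) (g := G k) (by simp)
        fun j hj => hGlow k j (by omega)
      rw [zero_add] at this
      rw [this]
      simp
    have h1 := map_coeff_eq_zero_of_pow_mul_eq (φ : MvPolynomial (Fin (n + 1)) ℂ →+*
      MvPolynomial (Fin n) ℂ) h0 hE0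
      hE1 hE1' hS (r := r) (fun i hi => by
        rw [hXD, map_sum]
        exact Finset.sum_eq_zero fun k _ => by
          rw [hcoef k i hi.le, hGlow k i hi, mul_zero])
    rw [hXD, map_sum] at h1
    simp_rw [hcoef _ r le_rfl, hG] at h1
    simp only [RingHom.coe_coe, map_sum, map_mul, hφr, hφC] at h1
    rw [hdf]
    have hpB : -(p : ℂ) * B ≠ 0 := by
      refine mul_ne_zero (neg_ne_zero.2 ?_) hbranch.2.1
      have := hbranch.1
      exact_mod_cast (by omega : p ≠ 0)
    have h2 : C (-(p : ℂ) * B) * ∑ k : Fin n, C (fall p k (s i)) *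
        aeval (fun k : Fin n => jetParam p s k) (pderiv k Pr) = 0 := by
      rw [← h1, Finset.mul_sum]
      refine Finset.sum_congr rfl fun k _ => ?_
      rw [← mul_assoc, ← C_mul, leadingJet_eq, Fin.val_succ, fall_succ_zero, hi]
      congr 2
      push_cast
      ring
    exact (mul_eq_zero.1 h2).resolve_left (C_ne_zero.2 hpB)
  intro d hd
  have hd := mem_support_iff.1 hd
  constructor
  · have h1 := congrArg (coeff d) hΦ1
    simp only [coeff_sum, coeff_C_mul, coeff_X_mul_pderiv] at h1
    have h2 : (∑ i, (s i : ℂ) * d i) * coeff d f = M * coeff d f := by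
      rw [← h1, Finset.sum_mul]
      exact Finset.sum_congr rfl fun i _ => by ring
    have h3 := mul_right_cancel₀ hd h2
    have h4 : (M : ℂ) = ((∑ i, (d i : ℤ) * s i : ℤ) : ℂ) := by
      rw [← h3]
      push_cast
      exact Finset.sum_congr rfl fun i _ => by ring
    exact_mod_cast h4
  · intro i hi
    have h1 := coeff_X_mul_pderiv f i d
    rw [hΦ2 i hi, mul_zero, coeff_zero] at h1
    exact_mod_cast (mul_eq_zero.1 h1.symm).resolve_right hd

/-! ### The value of a first integral and its dependence on the coefficients -/

/-- The value of the first integral `P` on the general Laurent solution `V`. -/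
def integralValue {A : Type*} [CommRing A] [Algebra ℂ A] (p : ℕ) (P : MvPolynomial (Fin n) ℂ)
    (V : PowerSeries A) : A :=
  ∑ M ∈ Finset.range (weightedTotalDegree (poleWeight p) P + 1), PowerSeries.coeff M
    (substSeries p (weightedHomogeneousComponent (poleWeight p) M P) V)

lemma integralValue_eq {A : Type*} [CommRing A] [Algebra ℂ A] {P : MvPolynomial (Fin n) ℂ} {M : ℕ}
    (hP : IsWeightedHomogeneous (poleWeight p) P M) (V : PowerSeries A) :
    integralValue p P V = PowerSeries.coeff M (substSeries p P V) := by
  rcases eq_or_ne P 0 with rfl | h0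
  · simp [integralValue, substSeries]
  have hD : weightedTotalDegree (poleWeight p) P = M := WithBot.coe_injective
    ((weightedTotalDegree_coe _ P h0).symm.trans (hP.weighted_total_degree h0))
  rw [integralValue, hD, Finset.sum_range_succ, Finset.sum_eq_zero,
    zero_add, hP.weightedHomogeneousComponent_same]
  intro i hi
  rw [hP.weightedHomogeneousComponent_ne i (Finset.mem_range.1 hi).ne]
  simp [substSeries]

lemma map_integralValue {A A' : Type*} [CommRing A] [Algebra ℂ A] [CommRing A'] [Algebra ℂ A']
    (φ : A →ₐ[ℂ] A') (P : MvPolynomial (Fin n) ℂ) (V : PowerSeries A) :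
    φ (integralValue p P V) = integralValue p P (PowerSeries.map (φ : A →+* A') V) := by
  simp only [integralValue, map_sum, ← map_substSeries, PowerSeries.coeff_map]
  rfl

lemma IsGeneralSolution.isWeightedHomogeneous_coeff
    {V : PowerSeries (MvPolynomial (posIndices E p B) ℂ)} (hV : IsGeneralSolution E p B V)
    (P : MvPolynomial (Fin n) ℂ) (M : ℕ) :
    IsWeightedHomogeneous (indexWeight (posIndices E p B))
      (PowerSeries.coeff M (substSeries p P V)) M :=
  substSeries_mem_gradedSeries
    (H := fun m : ℕ => weightedHomogeneousSubmodule ℂ (indexWeight (posIndices E p B)) m)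
    p P hV.homogeneous M

/-- The pole-order grading of `P` matches the weight grading in the `a_j`, so the components of `P`
can be studied separately. -/
lemma component_integralValue
    {V : PowerSeries (MvPolynomial (posIndices E p B) ℂ)} (hV : IsGeneralSolution E p B V)
    (P : MvPolynomial (Fin n) ℂ) (M : ℕ) :
    weightedHomogeneousComponent (indexWeight (posIndices E p B)) M (integralValue p P V) =
      PowerSeries.coeff M
        (substSeries p (weightedHomogeneousComponent (poleWeight p) M P) V) := by
  have h : ∀ i, IsWeightedHomogeneous (indexWeight (posIndices E p B)) (PowerSeries.coeff i
      (substSeries p (weightedHomogeneousComponent (poleWeight p) i P) V)) i :=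
    fun i => hV.isWeightedHomogeneous_coeff _ i
  rw [integralValue, map_sum, Finset.sum_eq_single M]
  · exact (h M).weightedHomogeneousComponent_same
  · intro i _ hi
    exact (h i).weightedHomogeneousComponent_ne _ hi.symm
  · intro hM
    have hM : weightedTotalDegree (poleWeight p) P < M := by
      simpa [Nat.lt_succ_iff] using hM
    rw [weightedHomogeneousComponent_eq_zero _ _ hM]
    simp [substSeries]

lemma HasPainlevePropertyAt.evalSeries_eq_C (hE : HasPainlevePropertyAt E p B)
    {P : MvPolynomial (Fin n) ℂ} (h : IsFirstIntegral (reducedEq p E) P) {v : PowerSeries ℂ}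
    (hv : PowerSeries.coeff 0 v = B) (hsol : substSeries p (reducedEq p E) v = 0) :
    evalSeries P (laurentOf p v) = HahnSeries.C (integralValue p P v) := by
  have h1 : evalSeries P (laurentOf p v) =
      ∑ M ∈ Finset.range (weightedTotalDegree (poleWeight p) P + 1),
        evalSeries (weightedHomogeneousComponent (poleWeight p) M P) (laurentOf p v) := by
    conv_lhs => rw [← sum_range_component (w := poleWeight p) P le_rfl]
    exact map_sum _ _ _
  rw [h1, integralValue, map_sum]
  refine Finset.sum_congr rfl fun M _ => ?_
  rw [evalSeries_laurentOf p (weightedHomogeneousComponent_isWeightedHomogeneous _ _)]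
  have h2 : substSeries p (weightedHomogeneousComponent (poleWeight p) M P) v =
      PowerSeries.C (PowerSeries.coeff M (substSeries p
        (weightedHomogeneousComponent (poleWeight p) M P) v)) * PowerSeries.X ^ M := by
    ext m
    rw [PowerSeries.coeff_C_mul, PowerSeries.coeff_X_pow]
    split_ifs with hm
    · rw [hm, mul_one]
    · rw [mul_zero]
      exact hE.coeff_substSeries_eq_zero (h.component M)
        (weightedHomogeneousComponent_isWeightedHomogeneous _ _) hv hsol hm
  rw [h2, laurentOf, map_mul, HahnSeries.ofPowerSeries_X_pow, HahnSeries.ofPowerSeries_C,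
    mul_left_comm, HahnSeries.single_mul_single]
  rw [← h2]
  simp

lemma IsGeneralSolution.evalSeries_eq {V : PowerSeries (MvPolynomial (posIndices E p B) ℂ)}
    (hV : IsGeneralSolution E p B V) (hE : HasPainlevePropertyAt E p B)
    {P : MvPolynomial (Fin n) ℂ} (h : IsFirstIntegral (reducedEq p E) P) {y : LaurentSeries ℂ}
    (hy : IsExpansion (reducedEq p E) p B y) :
    evalSeries P y = HahnSeries.C (eval
      (fun j : posIndices E p B => y.coeff ((j : ℤ) - p)) (integralValue p P V)) := by
  obtain ⟨v, rfl, hv, hsol⟩ := (isExpansion_reducedEq_iff y).1 hy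
  rw [hE.evalSeries_eq_C h hv hsol]
  congr 1
  have h1 := hV.map_eq v hv hsol
  have h2 := map_integralValue (p := p)
    (aeval fun j : posIndices E p B => PowerSeries.coeff (j : ℕ) v) P V
  rw [h1] at h2
  have h3 : (fun j : posIndices E p B => (laurentOf p v).coeff ((j : ℤ) - p)) =
      fun j : posIndices E p B => PowerSeries.coeff (j : ℕ) v :=
    _root_.funext fun j => coeff_laurentOf p v j
  rw [h3, ← h2, ← coe_aeval_eq_eval]
  rfl

/-- At a general branch, a first integral whose value on the general Laurent solution does not
depend on the arbitrary coefficients is constant. -/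
lemma IsGeneralSolution.eq_C_of_integralValue_eq_C (hbranch : IsPoleBranch E p B)
    {V : PowerSeries (MvPolynomial (posIndices E p B) ℂ)}
    (hV : IsGeneralSolution E p B V) (hE : HasPainlevePropertyAt E p B)
    (hgen : IsGeneralBranch E p B) {P : MvPolynomial (Fin n) ℂ}
    (h : IsFirstIntegral (reducedEq p E) P) {c : ℂ} (hc : integralValue p P V = C c) : P = C c := by
  have hcomp : ∀ M, PowerSeries.coeff M (substSeries p
      (weightedHomogeneousComponent (poleWeight p) M P) V) =
      weightedHomogeneousComponent (indexWeight (posIndices E p B)) M (C c) := by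
    intro M
    rw [← component_integralValue hV, hc]
  have hpos : ∀ M, M ≠ 0 → weightedHomogeneousComponent (poleWeight p) M P = 0 := by
    intro M hM
    have hPM := weightedHomogeneousComponent_isWeightedHomogeneous (w := poleWeight p) M P
    refine hV.eq_zero_of_substSeries_eq_zero hbranch.1 hbranch.2.1 hE hgen hPM ?_
    have h0 := hcomp M
    rw [(isWeightedHomogeneous_C _ c).weightedHomogeneousComponent_ne _ hM] at h0
    ext1 m
    rw [map_zero]
    rcases eq_or_ne m M with rfl | hm
    · exact h0
    -- Away from position `M`, vanishing is known on actual solutions; every point `a` is realized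
    -- by one, so the coefficient vanishes as a polynomial.
    refine MvPolynomial.funext fun a => ?_
    classical
    obtain ⟨v, hv, hsol, hva⟩ := hE.exists_solution
      fun j => if hj : j ∈ posIndices E p B then a ⟨j, hj⟩ else 0
    have ha : (fun j : posIndices E p B => PowerSeries.coeff (j : ℕ) v) = a := by
      ext1 j
      rw [hva j j.2, dif_pos j.2]
    have h1 := hV.map_eq v hv hsol
    rw [ha] at h1
    have h2 := hE.coeff_substSeries_eq_zero (h.component M) hPM hv hsol hm
    rw [← h1, ← map_substSeries, PowerSeries.coeff_map] at h2
    rw [map_zero, ← h2, ← coe_aeval_eq_eval]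
  have hP : weightedHomogeneousComponent (poleWeight p) 0 P = P := by
    conv_rhs => rw [← sum_range_component (w := poleWeight p) P le_rfl]
    rw [Finset.sum_eq_single 0]
    · intro M _ hM
      exact hpos M hM
    · simp
  have hPC := eq_C_of_isWeightedHomogeneous_zero hbranch.1
    (weightedHomogeneousComponent_isWeightedHomogeneous (w := poleWeight p) 0 P)
  have h0 := hcomp 0
  rw [hP] at hPC
  rw [hP, (isWeightedHomogeneous_C _ c).weightedHomogeneousComponent_same, hPC] at h0
  simp only [substSeries, aeval_C] at h0
  rw [PowerSeries.algebraMap_apply, PowerSeries.coeff_zero_C, algebraMap_eq,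
    C_inj] at h0
  rw [hPC, h0]

/-- The recursion formula compares `V` with its truncation before `M`. The truncation involves only
`a_i` with `i < M`, since a coefficient of weight below `M` cannot contain a variable of larger
weight. -/
lemma IsGeneralSolution.integralValue_eq_add {V : PowerSeries (MvPolynomial (posIndices E p B) ℂ)}
    (hV : IsGeneralSolution E p B V) {P : MvPolynomial (Fin n) ℂ} {M : ℕ}
    (hP : IsWeightedHomogeneous (poleWeight p) P M) {j : posIndices E p B} (hj : (j : ℕ) = M) :
    ∃ R : MvPolynomial (posIndices E p B) ℂ, (∀ i ∈ R.vars, (i : ℕ) < M) ∧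
      integralValue p P V = C ((linearization P p B).eval (M : ℂ)) * X j + R := by
  classical
  set V' : PowerSeries (MvPolynomial (posIndices E p B) ℂ) :=
    PowerSeries.mk fun i => if i < M then PowerSeries.coeff i V else 0 with hV'
  have hM : 1 ≤ M := hj ▸ ((mem_posIndices _).1 j.2).1
  refine ⟨PowerSeries.coeff M (substSeries p P V'), ?_, ?_⟩
  · let S : Subalgebra ℂ (MvPolynomial (posIndices E p B) ℂ) := supported ℂ {i | (i : ℕ) < M}
    have hmem : V' ∈ gradedSeries (fun _ : ℕ => Subalgebra.toSubmodule S) := by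
      intro i
      rw [hV', PowerSeries.coeff_mk]
      split_ifs with hi
      · refine mem_supported.2 fun k hk => ?_
        by_contra hkM
        have hki : i < indexWeight (posIndices E p B) k :=
          lt_of_lt_of_le hi (not_lt.1 hkM)
        obtain ⟨d, hd, hdk⟩ := (mem_vars_iff_mem_support k).1 hk
        have h1 := hV.homogeneous i (mem_support_iff.1 hd)
        have h2 : indexWeight (posIndices E p B) k ≤
            Finsupp.weight (indexWeight (posIndices E p B)) d :=
          Finsupp.le_weight_of_ne_zero' _ (Finsupp.mem_support_iff.1 hdk)
        omega
      · exact Submodule.zero_mem _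
    have h1 : PowerSeries.coeff M (substSeries p P V') ∈ S :=
      substSeries_mem_gradedSeries p P hmem M
    exact fun i hi => mem_supported.1 h1 hi
  · have h1 := coeff_substSeries_sub p B hM P V V' hV.coeff_zero (fun i hi => by simp [hV', hi])
    rw [hV', PowerSeries.coeff_mk, if_neg (lt_irrefl M), sub_zero, ← hV',
      sub_eq_iff_eq_add] at h1
    have h2 := hV.coeff_index j
    rw [hj] at h2
    rw [integralValue_eq hP, h1, h2, smul_eq_C_mul]

lemma HasPainlevePropertyAt.exists_combination (hbranch : IsPoleBranch E p B)
    (hE : HasPainlevePropertyAt E p B) {P : MvPolynomial (Fin n) ℂ}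
    (h : IsFirstIntegral (reducedEq p E) P) {d : Fin n →₀ ℕ} (hd : d ∈ P.support) :
    ∃ k : ℤ → ℕ, (Finsupp.weight (poleWeight p) d : ℤ) =
      ∑ j ∈ (fuchsIndices E p B).erase (-1), (k j : ℤ) * j := by
  classical
  obtain ⟨s, hs, hsT⟩ := hE.exists_enumeration
  set M := Finsupp.weight (poleWeight p) d
  have hne : weightedHomogeneousComponent (poleWeight p) M P ≠ 0 := by
    intro h0
    have := congrArg (coeff d) h0
    rw [coeff_weightedHomogeneousComponent, if_pos rfl, coeff_zero] at this
    exact mem_support_iff.1 hd this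
  obtain ⟨r, -, f, -, hf, hfd⟩ := hE.exists_lowest_term hbranch hs hsT (h.component M)
    (weightedHomogeneousComponent_isWeightedHomogeneous _ _) hne
  obtain ⟨e, he⟩ := support_nonempty.2 hf
  obtain ⟨hM, h1⟩ := hfd e he
  -- The multiplicities are the exponents of one monomial of the lowest term; they vanish at the
  -- index `-1`.
  refine ⟨Function.extend s e 0, ?_⟩
  have hT : fuchsIndices E p B = Finset.univ.image s := by
    ext j
    simp [hsT]
  rw [hM, Finset.sum_erase, hT, Finset.sum_image hs.injOn]
  · simp only [hs.extend_apply]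
  · by_cases hi : ∃ i, s i = -1
    · obtain ⟨i, hi⟩ := hi
      rw [← hi, hs.extend_apply, h1 i hi]
      simp
    · rw [Function.extend_apply' _ _ _ hi]
      simp

lemma HasPainlevePropertyAt.mem_posIndices_of_pderiv_ne_zero (hbranch : IsPoleBranch E p B)
    (hE : HasPainlevePropertyAt E p B) {P : MvPolynomial (Fin n) ℂ}
    (h : IsFirstIntegral (reducedEq p E) P) {M : ℕ}
    (hM : IsWeightedHomogeneous (poleWeight p) P M)
    (hk : ∃ k : Fin n, eval (leadingJet p B) (pderiv k P) ≠ 0) :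
    M ∈ posIndices E p B ∧ (linearization P p B).eval (M : ℂ) ≠ 0 := by
  classical
  obtain ⟨k, hk⟩ := hk
  obtain ⟨s, hs, hsT⟩ := hE.exists_enumeration
  have hP0 : P ≠ 0 := by
    rintro rfl
    simp at hk
  have hM0 : M ≠ 0 := by
    rintro rfl
    rw [eq_C_of_isWeightedHomogeneous_zero hbranch.1 hM, pderiv_C] at hk
    simp at hk
  obtain ⟨r, hr, f, hf, hf0, hfd⟩ := hE.exists_lowest_term hbranch hs hsT h hM hP0
  have hr1 : r ≤ 1 := by
    by_contra hr1
    have h1 := hr 1 (by omega)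
    rw [coeff_one_expandAt] at h1
    have h2 := congrArg (eval (Pi.single k 1)) h1
    simp only [map_sum, map_mul, algebraMap_eq, eval_C, eval_X, map_zero] at h2
    rw [Finset.sum_eq_single k] at h2
    · rw [Pi.single_eq_same, mul_one] at h2
      exact hk h2
    · intro i _ hi
      rw [Pi.single_eq_of_ne hi, mul_zero]
    · simp
  interval_cases r
  -- A nonzero constant lowest term would have weight `M = 0`, which is excluded because then `P` is
  -- constant.
  · rw [coeff_zero_expandAt, AlgHom.commutes, algebraMap_eq] at hf
    have h0 : (0 : Fin n →₀ ℕ) ∈ f.support := by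
      rw [mem_support_iff, hf, coeff_zero_C]
      rintro h0
      exact hf0 (by rw [hf, h0, C_0])
    have := (hfd 0 h0).1
    simp at this
    exact absurd this hM0
  -- For `r = 1` the lowest term is `∑ Λ_P(s_i) t_i`; any monomial present forces `M = s_i` with
  -- `Λ_P(s_i) ≠ 0`.
  · have hlin : f = ∑ i, C ((linearization P p B).eval (s i : ℂ)) * X i := by
      rw [hf, coeff_one_expandAt]
      simp only [map_sum, map_mul, aeval_X, algebraMap_eq, algHom_C, jetParam, Finset.mul_sum,
        eval_linearization, Finset.sum_mul]
      rw [Finset.sum_comm]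
      refine Finset.sum_congr rfl fun i _ => Finset.sum_congr rfl fun k _ => ?_
      ring
    have hi : ∃ i, (linearization P p B).eval (s i : ℂ) ≠ 0 := by
      by_contra! hi
      refine hf0 (hlin.trans (Finset.sum_eq_zero fun i _ => ?_))
      rw [hi i, C_0, zero_mul]
    obtain ⟨i, hi⟩ := hi
    have hmem : Finsupp.single i 1 ∈ f.support := by
      rw [mem_support_iff, hlin, coeff_sum, Finset.sum_eq_single i]
      · simpa [coeff_C_mul] using hi
      · intro j _ hj
        rw [coeff_C_mul, coeff_X, if_neg, mul_zero]
        intro h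
        exact hj (Finsupp.single_left_injective one_ne_zero h)
      · simp
    have hMi : (M : ℤ) = s i := by
      have := (hfd _ hmem).1
      rw [Finset.sum_eq_single i] at this
      · simpa using this
      · intro j _ hj
        simp [Finsupp.single_eq_of_ne hj]
      · simp
    refine ⟨(mem_posIndices M).2 ⟨Nat.pos_of_ne_zero hM0, (hsT _).2 ⟨i, hMi.symm⟩⟩, ?_⟩
    rw [← hMi] at hi
    simpa using hi

end PainleveFirstIntegral

end

theorem theorem2p1 (n : ℕ) (E : MvPolynomial (Fin (n + 1)) ℂ) (p : ℕ) (B : ℂ)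
    (hbranch : PainleveFirstIntegral.IsPoleBranch E p B)
    (hP : PainleveFirstIntegral.HasPainlevePropertyAt E p B) :
    -- the coefficients at the positive Fuchs indices are arbitrary for the reduced equation too,
    -- and they determine its Laurent solution
    (∀ a : PainleveFirstIntegral.posIndices E p B → ℂ, ∃! y : LaurentSeries ℂ,
      PainleveFirstIntegral.IsExpansion (PainleveFirstIntegral.reducedEq p E) p B y ∧
        ∀ j : PainleveFirstIntegral.posIndices E p B, y.coeff ((j : ℤ) - p) = a j) ∧
    ∀ P : MvPolynomial (Fin n) ℂ,
      PainleveFirstIntegral.IsFirstIntegral (PainleveFirstIntegral.reducedEq p E) P →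
      -- the members of any given pole order form a first integral by themselves
      (∀ M : ℕ, PainleveFirstIntegral.IsFirstIntegral (PainleveFirstIntegral.reducedEq p E)
        (MvPolynomial.weightedHomogeneousComponent
          (PainleveFirstIntegral.poleWeight p) M P)) ∧
      -- pole orders of the members are combinations of the Fuchs indices other than `-1`
      (∀ d ∈ P.support, ∃ k : ℤ → ℕ,
        (Finsupp.weight (PainleveFirstIntegral.poleWeight p) d : ℤ) =
          ∑ j ∈ (PainleveFirstIntegral.fuchsIndices E p B).erase (-1), (k j : ℤ) * j) ∧
      -- the constant of the first integral as a polynomial `Q` in the arbitrary coefficients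
      ∃ Q : MvPolynomial (PainleveFirstIntegral.posIndices E p B) ℂ,
        (∀ y : LaurentSeries ℂ,
          PainleveFirstIntegral.IsExpansion (PainleveFirstIntegral.reducedEq p E) p B y →
          PainleveFirstIntegral.evalSeries P y =
            HahnSeries.C (MvPolynomial.eval
              (fun j : PainleveFirstIntegral.posIndices E p B => y.coeff ((j : ℤ) - p)) Q)) ∧
        (PainleveFirstIntegral.IsGeneralBranch E p B →
          ∀ c : ℂ, Q = MvPolynomial.C c → P = MvPolynomial.C c) ∧
        ∀ M : ℕ, MvPolynomial.IsWeightedHomogeneous (PainleveFirstIntegral.poleWeight p) P M →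
          MvPolynomial.IsWeightedHomogeneous
            (fun j : PainleveFirstIntegral.posIndices E p B => (j : ℕ)) Q M ∧
          (∀ j : PainleveFirstIntegral.posIndices E p B, (j : ℕ) = M →
            ∃ R : MvPolynomial (PainleveFirstIntegral.posIndices E p B) ℂ,
              (∀ i ∈ R.vars, (i : ℕ) < M) ∧
              Q = MvPolynomial.C
                ((PainleveFirstIntegral.linearization P p B).eval (M : ℂ)) *
                  MvPolynomial.X j + R) ∧
          ((∃ k : Fin n, MvPolynomial.eval (PainleveFirstIntegral.leadingJet p B)
              (MvPolynomial.pderiv k P) ≠ 0) →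
            M ∈ PainleveFirstIntegral.posIndices E p B ∧
              (PainleveFirstIntegral.linearization P p B).eval (M : ℂ) ≠ 0) := by
  refine ⟨hP.existsUnique_isExpansion, fun P hfirst => ⟨hfirst.component,
    fun d hd => hP.exists_combination hbranch hfirst hd, ?_⟩⟩
  obtain ⟨V, hV⟩ := hP.exists_isGeneralSolution
  refine ⟨PainleveFirstIntegral.integralValue p P V, fun y hy => hV.evalSeries_eq hP hfirst hy,
    fun hgen c hc => hV.eq_C_of_integralValue_eq_C hbranch hP hgen hfirst hc,
    fun M hM => ⟨?_, fun j hj => hV.integralValue_eq_add hM hj,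
      hP.mem_posIndices_of_pderiv_ne_zero hbranch hfirst hM⟩⟩
  rw [PainleveFirstIntegral.integralValue_eq hM]
  exact hV.isWeightedHomogeneous_coeff P M
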